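/- **Setting.** There are $N$ servers, $K\ge 1$ messages and $M\ge 1$ communication links, given by a binary $N\times M$ matrix $B_X$; the $m$-th link is $\mathcal X_m=\{n: B_X(n,m)=1\}$. Put $\mathcal X=\{\mathcal X_1,\dots,\mathcal X_M\}$ and $\lambda=\max_n\sum_{m=1}^M(1-B_X(n,m))$. *Grouping.* A feasible grouping is a binary $\lceil N/2\rceil\times N$ matrix $\Lambda$ with rows $\Lambda_i$ such that: every nonzero row satisfies $\Lambda_iB_X^c\ge \mathbf 1$ entrywise, where $B_X^c=\mathbf 1-B_X$ (no group is contained in a link); $\sum_j\Lambda(i,j)\ne 1$ for all $i$; and distinct rows are orthogonal. The groups are the supports of the nonzero rows. An optimal grouping is a feasible one with the largest number of groups; let $g$ be this number and $M_i$ the sizes of the groups $G_1,\dots,G_g$ of a fixed optimal grouping. *Schemes and capacity.* Let $\mathbb F_q$ be a finite field. A scheme has a message length $L\ge1$ and independent random variables: the messages $W_1,\dots,W_K$, independent and uniform on $\mathbb F_q^L$, a storage noise $Z$, a user key $U$, and the index $\Theta$ of the wanted message, uniform on $[K]$. Server $n$ stores $S_n=\Psi_n(W_{[K]},Z)\in\mathbb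 F_q^{a_n}$; its query for message $k$ is a function $Q_n^{[k]}$ of $k$ and $U$ (so the queries are independent of the messages and of the storage); its answer is $A_n^{[k]}=\phi_n(Q_n^{[k]},S_n)\in\mathbb F_q^{b_n}$, where $\phi_n$ does not depend on $k$. All alphabets are finite. Given a family $\mathcal T$ of colluding sets, a scheme is admissible if - (security) $I(W_{[K]};S_n)=0$ for each server $n$ and $I(W_{[K]};S_{X})=0$ for each link $X\in\mathcal X$; - (privacy) $I(\Theta;Q_n^{[\Theta]})=0$ for each server $n$ and $I(\Theta;Q_T^{[\Theta]})=0$ for each $T\in\mathcal T$; - (decodability) $H(W_k\mid A_{[N]}^{[k]},Q_{[N]}^{[k]})=0$ for each $k\in[K]$. It achieves the rate $R$ if $R\le L/\sum_{n=1}^N H(A_n^{[k]})$ for each $k$, entropies being in $q$-ary units. The capacity $C(N,K,\mathcal X,\mathcal T)$ is the supremum of the rates achieved by admissible schemes, over all $L$. Put $C_{PIR}(g,K)=\left(1+\frac1g+\dots+\frac1{g^{K-1}}\right)^{-1}$ and $\eta_K(\mathcal X_m)=\sum_{i=1}^{K-1}\left(\frac{1}{N-|\mathcal X_m|}\right)^i$.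 **Theorem.** Suppose that $g\ge1$, that $\frac{\lambda}{M}=\frac{g}{\sum_iM_i}$, and that $|\mathcal X_m|=N-g$ for all $m\in[M]$. Let $\mathcal T=\{G_1,\dots,G_g\}$. Then, for every finite field $\mathbb F_q$, $$C(N,K,\mathcal X,\mathcal T)=\frac{\lambda}{M\left(1+\eta_K(\mathcal X_1)\right)}=\frac{\lambda}{M}\,C_{PIR}(N-|\mathcal X_1|,K)=\frac{\lambda}{M}\,C_{PIR}(g,K).$$ -/

import Mathlib

namespace AXPIR

noncomputable section

/-! ### Entropies of discrete random variables, in `q`-ary units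

A random variable is a function on the sample space `Ω` of a `PMF`. -/

/-- The entropy `H(X)`, with logarithms to base `q`. -/
def entropy (q : ℕ) {Ω β : Type} [Fintype β] (P : PMF Ω) (X : Ω → β) : ℝ :=
  (∑ x, Real.negMulLog ((P.map X) x).toReal) / Real.log q

/-- The conditional entropy `H(X | Y) = H(X, Y) - H(Y)`. -/
def condEntropy (q : ℕ) {Ω β γ : Type} [Fintype β] [Fintype γ] (P : PMF Ω)
    (X : Ω → β) (Y : Ω → γ) : ℝ :=
  entropy q P (fun ω => (X ω, Y ω)) - entropy q P Y

/-- The mutual information `I(X ; Y) = H(X) + H(Y) - H(X, Y)`. -/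
def mutualInfo (q : ℕ) {Ω β γ : Type} [Fintype β] [Fintype γ] (P : PMF Ω)
    (X : Ω → β) (Y : Ω → γ) : ℝ :=
  entropy q P X + entropy q P Y - entropy q P (fun ω => (X ω, Y ω))

/-! ### Communication matrices and groupings of the servers -/

/-- All entries are `0` or `1`. -/
def IsBinary {m n : Type} (A : Matrix m n ℕ) : Prop := ∀ i j, A i j = 0 ∨ A i j = 1

/-- The binary complement of a binary matrix. -/
def compl {m n : Type} (A : Matrix m n ℕ) : Matrix m n ℕ := fun i j => 1 - A i j

/-- The set of servers in the `m`-th communication link. -/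
def link {N M : ℕ} (B : Matrix (Fin N) (Fin M) ℕ) (m : Fin M) : Finset (Fin N) :=
  Finset.univ.filter fun n => B n m = 1

/-- The family of all communication links. -/
def links {N M : ℕ} (B : Matrix (Fin N) (Fin M) ℕ) : Finset (Finset (Fin N)) :=
  Finset.univ.image (link B)

/-- `max_n ∑_m (1 - B(n, m))`: the largest number of links that one server does not belong to. -/
def lam {N M : ℕ} (B : Matrix (Fin N) (Fin M) ℕ) : ℕ :=
  Finset.univ.sup fun n => ∑ m, compl B n m

/-- A similarity matrix: the `i`-th row is the indicator of the `i`-th group, or zero if the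
row is not used. -/
abbrev SimilarityMatrix (N : ℕ) : Type := Matrix (Fin ⌈(N : ℚ) / 2⌉₊) (Fin N) ℕ

open scoped Classical in
/-- The number of nonzero rows, that is, the number of groups. -/
def numGroups {N : ℕ} (Λ : SimilarityMatrix N) : ℕ :=
  (Finset.univ.filter fun i => Matrix.row Λ i ≠ 0).card

/-- The `i`-th group of servers. -/
def group {N : ℕ} (Λ : SimilarityMatrix N) (i : Fin ⌈(N : ℚ) / 2⌉₊) : Finset (Fin N) :=
  Finset.univ.filter fun j => Λ i j = 1

open scoped Classical in
/-- The family of all groups. -/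
def groups {N : ℕ} (Λ : SimilarityMatrix N) : Finset (Finset (Fin N)) :=
  (Finset.univ.filter fun i => Matrix.row Λ i ≠ 0).image (group Λ)

/-- The constraints of the grouping problem. The security constraint concerns the rows that are
in use, since a zero row is not a group. -/
structure IsFeasible {N M : ℕ} (B : Matrix (Fin N) (Fin M) ℕ) (Λ : SimilarityMatrix N) :
    Prop where
  binary : IsBinary Λ
  /-- Every group has, for every link, a member outside this link. -/
  secure : ∀ i, Matrix.row Λ i ≠ 0 → ∀ m, 1 ≤ (Λ * compl B) i m
  no_singleton : ∀ i, ∑ j, Λ i j ≠ 1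
  orthogonal : ∀ i j, i ≠ j → Matrix.row Λ i ⬝ᵥ Matrix.row Λ j = 0

/-- `Λ` solves the grouping problem: it is feasible, and has the largest number of groups. -/
def IsOptimalGrouping {N M : ℕ} (B : Matrix (Fin N) (Fin M) ℕ) (Λ : SimilarityMatrix N) :
    Prop :=
  IsFeasible B Λ ∧ ∀ Λ' : SimilarityMatrix N, IsFeasible B Λ' → numGroups Λ' ≤ numGroups Λ

/-! ### Retrieval schemes -/

/-- A storage and retrieval scheme for `K` messages in `F ^ L` on `N` servers. The storage is
encoded from the messages and a random noise, the queries from the index of the wanted message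
and a random key of the user, and an answer is a deterministic function of the query and the
storage at the server. -/
structure Scheme (F : Type) (N K : ℕ) where
  /-- The message length. -/
  L : ℕ
  L_pos : 0 < L
  /-- The alphabet of the storage noise. -/
  Noise : Type
  [fintypeNoise : Fintype Noise]
  noiseLaw : PMF Noise
  /-- The alphabet of the private randomness of the user. -/
  Key : Type
  [fintypeKey : Fintype Key]
  keyLaw : PMF Key
  /-- The query alphabet. -/
  Query : Type
  [fintypeQuery : Fintype Query]
  storageLen : Fin N → ℕ
  answerLen : Fin N → ℕ
  encode : (n : Fin N) → (Fin K → Fin L → F) → Noise → (Fin (storageLen n) → F)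
  query : Fin K → Key → Fin N → Query
  answer : (n : Fin N) → Query → (Fin (storageLen n) → F) → (Fin (answerLen n) → F)

attribute [instance] Scheme.fintypeNoise Scheme.fintypeKey Scheme.fintypeQuery

namespace Scheme

variable {F : Type} {N K : ℕ}

/-- An outcome consists of the messages, the storage noise, the key of the user and the index
of the wanted message. -/
abbrev Outcome (σ : Scheme F N K) : Type :=
  (Fin K → Fin σ.L → F) × σ.Noise × σ.Key × Fin K

/-- The messages `W_1, …, W_K`. -/
def W (σ : Scheme F N K) (ω : σ.Outcome) : Fin K → Fin σ.L → F := ω.1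

/-- The index `Θ` of the wanted message. -/
def Θ (σ : Scheme F N K) (ω : σ.Outcome) : Fin K := ω.2.2.2

/-- The storage `S_n` at the server `n`. -/
def S (σ : Scheme F N K) (n : Fin N) (ω : σ.Outcome) : Fin (σ.storageLen n) → F :=
  σ.encode n ω.1 ω.2.1

/-- The query `Q_n^{[k]}` to the server `n` when the message `k` is wanted. -/
def Q (σ : Scheme F N K) (k : Fin K) (n : Fin N) (ω : σ.Outcome) : σ.Query :=
  σ.query k ω.2.2.1 n

/-- The answer `A_n^{[k]}` of the server `n` when the message `k` is wanted. -/
def A (σ : Scheme F N K) (k : Fin K) (n : Fin N) (ω : σ.Outcome) : Fin (σ.answerLen n) → F :=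
  σ.answer n (σ.Q k n ω) (σ.S n ω)

variable [Field F] [Fintype F] [NeZero K]

/-- The joint law: uniform messages, noise, key and a uniform index, all independent. -/
def law (σ : Scheme F N K) : PMF σ.Outcome :=
  (PMF.uniformOfFintype (Fin K → Fin σ.L → F)).bind fun w =>
    σ.noiseLaw.bind fun z =>
      σ.keyLaw.bind fun u =>
        (PMF.uniformOfFintype (Fin K)).map fun θ => (w, z, u, θ)

/-- The servers in `X` together store nothing about the messages: `I(W ; S_X) = 0`. -/
def SecureAgainst (σ : Scheme F N K) (X : Finset (Fin N)) : Prop :=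
  mutualInfo (Fintype.card F) σ.law σ.W (fun ω (n : X) => σ.S n ω) = 0

/-- The servers in `T` together learn nothing about the index of the wanted message from the
queries that they receive: `I(Θ ; Q_T^{[Θ]}) = 0`. -/
def PrivateAgainst (σ : Scheme F N K) (T : Finset (Fin N)) : Prop :=
  mutualInfo (Fintype.card F) σ.law σ.Θ (fun ω (n : T) => σ.Q (σ.Θ ω) n ω) = 0

/-- The user, who knows the queries, recovers the wanted message from the answers:
`H(W_k | A_{[N]}^{[k]}, Q_{[N]}^{[k]}) = 0` for all `k`. -/
def Decodable (σ : Scheme F N K) : Prop :=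
  ∀ k, condEntropy (Fintype.card F) σ.law (fun ω => σ.W ω k)
    (fun ω => ((fun n => σ.A k n ω), (fun n => σ.Q k n ω))) = 0

/-- The scheme is secure against every single server and every link in `𝒳`, private against every
single server and every colluding set in `𝒯`, and decodable. -/
structure IsAdmissible (σ : Scheme F N K) (𝒳 𝒯 : Finset (Finset (Fin N))) : Prop where
  secure_single : ∀ n, σ.SecureAgainst {n}
  secure_link : ∀ X ∈ 𝒳, σ.SecureAgainst X
  private_single : ∀ n, σ.PrivateAgainst {n}
  private_collusion : ∀ T ∈ 𝒯, σ.PrivateAgainst T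
  decodable : σ.Decodable

/-- The rate `L / ∑_n H(A_n^{[k]})`. -/
def rate (σ : Scheme F N K) (k : Fin K) : ℝ :=
  (σ.L : ℝ) / ∑ n, entropy (Fintype.card F) σ.law (σ.A k n)

end Scheme

/-- The rates that are achieved, whichever message is wanted, by some admissible scheme
(of any message length). -/
def achievableRates (F : Type) [Field F] [Fintype F] (N K : ℕ) [NeZero K]
    (𝒳 𝒯 : Finset (Finset (Fin N))) : Set ℝ :=
  {R | ∃ σ : Scheme F N K, σ.IsAdmissible 𝒳 𝒯 ∧ ∀ k, R ≤ σ.rate k}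

/-- `C` is the capacity: the supremum of the achievable rates. -/
def IsCapacity (F : Type) [Field F] [Fintype F] (N K : ℕ) [NeZero K]
    (𝒳 𝒯 : Finset (Finset (Fin N))) (C : ℝ) : Prop :=
  IsLUB (achievableRates F N K 𝒳 𝒯) C

/-- `C_PIR(g, K) = (1 + 1/g + ⋯ + 1/g^(K-1))⁻¹`. -/
def CPIR (g K : ℕ) : ℝ := (∑ i ∈ Finset.range K, (1 / (g : ℝ)) ^ i)⁻¹

/-- `η_{K,T}(X) = ∑_{i=1}^{K-1} (T / (N - |X|))^i`. -/
def etaT {N : ℕ} (K T : ℕ) (X : Finset (Fin N)) : ℝ :=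
  ∑ i ∈ Finset.Ico 1 K, ((T : ℝ) / ((N : ℝ) - (X.card : ℝ))) ^ i

/-- `η_K(X) = η_{K,1}(X)`. -/
def eta {N : ℕ} (K : ℕ) (X : Finset (Fin N)) : ℝ := etaT K 1 X

end

end AXPIR

/-! Converse. Fix a link X. Its storage is independent of the messages, so given this storage and
the key, the g servers outside X still have to deliver the wanted message. Let the residual be the
entropy of their answers given the storage in X, the key and a set J of known messages. Decodability
makes it drop by at least the entropy of one message when the wanted message joins J
(`Scheme.add_residual_insert_le`). Privacy of single servers lets the wanted message be switched at
the price of a factor g (`Scheme.residual_le_card_mul`). Iterating gives the geometric sum D = 1 +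
1/g + ⋯ + 1/g^(K-1): the servers outside any link download at least L·D. Each server is outside at
most λ links, so summing over the links gives M·L·D ≤ λ · (total download), that is, a rate of at
most λ/(M·D).

Achievability. Every link misses a member of every group, so counting the pairs of a link and a
member outside it gives M ≤ λ·M_i. The condition λ/M = g/∑M_i turns all these inequalities into
equalities, and every group has s = M/λ members. Take a private retrieval scheme for g replicated
servers whose answers are additive in the database, share the database additively within each group,
and send one common query to the whole group. The answers of a group then add up to the answer of
the replicated server. No link holds all the shares of a group, and a colluding group sees only one
query.

The replicated scheme (`LinearPIR.cyclicPIR`) has message length g - 1 in packets. One server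
receives a null query with probability g/g^K and then replies by zero. Since cost is measured by
entropy, packets of length ℓ cost at most (g - g/g^K)ℓ + 1 = D(g-1)ℓ + 1. After the factor s, the
rates tend to 1/(s·D) = λ/(M·D) as ℓ grows. -/

namespace AXPIR

noncomputable section

/-! ### Shannon entropy on finite probability spaces. -/

section Entropy

variable {Ω α β γ : Type}

/-- The probability that `X = x`. -/
def prob (P : PMF Ω) (X : Ω → β) (x : β) : ℝ := ((P.map X) x).toReal

/-- The entropy in natural units. -/
def ent [Fintype β] (P : PMF Ω) (X : Ω → β) : ℝ := ∑ x, Real.negMulLog (prob P X x)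

theorem entropy_eq_ent_div (q : ℕ) [Fintype β] (P : PMF Ω) (X : Ω → β) :
    entropy q P X = ent P X / Real.log q := rfl

theorem prob_nonneg (P : PMF Ω) (X : Ω → β) (x : β) : 0 ≤ prob P X x := ENNReal.toReal_nonneg

variable [Fintype Ω]

open scoped Classical in
theorem prob_eq_sum (P : PMF Ω) (X : Ω → β) (x : β) :
    prob P X x = ∑ ω, if X ω = x then (P ω).toReal else 0 := by
  unfold prob
  rw [PMF.map_apply, tsum_fintype, ENNReal.toReal_sum]
  · refine Finset.sum_congr rfl fun ω _ => ?_
    by_cases h : X ω = x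
    · simp [h]
    · simp [h, Ne.symm h]
  · intro ω _
    split_ifs
    · exact P.apply_ne_top ω
    · simp

theorem sum_prob_mul [Fintype β] (P : PMF Ω) (X : Ω → β) (f : β → ℝ) :
    ∑ x, prob P X x * f x = ∑ ω, (P ω).toReal * f (X ω) := by
  classical
  simp_rw [prob_eq_sum, Finset.sum_mul]
  rw [Finset.sum_comm]
  refine Finset.sum_congr rfl fun ω _ => ?_
  simp [ite_mul]

theorem sum_toReal_eq_one (P : PMF Ω) : ∑ ω, (P ω).toReal = 1 := by
  rw [← ENNReal.toReal_sum fun ω _ => P.apply_ne_top ω]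
  have := P.tsum_coe
  rw [tsum_fintype] at this
  simp [this]

theorem sum_prob [Fintype β] (P : PMF Ω) (X : Ω → β) : ∑ x, prob P X x = 1 := by
  have := sum_prob_mul P X fun _ => 1
  simpa [sum_toReal_eq_one] using this

theorem ent_eq_sum [Fintype β] (P : PMF Ω) (X : Ω → β) :
    ent P X = ∑ ω, (P ω).toReal * -Real.log (prob P X (X ω)) := by
  rw [← sum_prob_mul P X fun x => -Real.log (prob P X x)]
  simp [ent, Real.negMulLog]

theorem prob_le_prob_of_factor (P : PMF Ω) {X : Ω → β} {Y : Ω → γ}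
    (h : ∀ ω ω', Y ω = Y ω' → X ω = X ω') (ω : Ω) :
    prob P Y (Y ω) ≤ prob P X (X ω) := by
  classical
  rw [prob_eq_sum, prob_eq_sum]
  refine Finset.sum_le_sum fun ω' _ => ?_
  by_cases h1 : Y ω' = Y ω
  · rw [if_pos h1, if_pos (h _ _ h1)]
  · rw [if_neg h1]
    split_ifs <;> simp

theorem le_prob (P : PMF Ω) (X : Ω → β) (ω : Ω) : (P ω).toReal ≤ prob P X (X ω) := by
  classical
  rw [prob_eq_sum]
  have := Finset.single_le_sum (f := fun ω' => if X ω' = X ω then (P ω').toReal else 0)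
    (fun i _ => by split_ifs <;> simp) (Finset.mem_univ ω)
  simpa using this

/-- A function of `Y` has at most the entropy of `Y`. -/
theorem ent_le_of_factor [Fintype β] [Fintype γ] (P : PMF Ω) {X : Ω → β} {Y : Ω → γ}
    (h : ∀ ω ω', Y ω = Y ω' → X ω = X ω') : ent P X ≤ ent P Y := by
  rw [ent_eq_sum, ent_eq_sum]
  refine Finset.sum_le_sum fun ω _ => ?_
  rcases eq_or_lt_of_le (ENNReal.toReal_nonneg (a := P ω)) with h0 | h0
  · simp [← h0]
  · have h1 := lt_of_lt_of_le h0 (le_prob P Y ω)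
    exact mul_le_mul_of_nonneg_left
      (neg_le_neg (Real.log_le_log h1 (prob_le_prob_of_factor P h ω))) h0.le

theorem ent_congr [Fintype β] [Fintype γ] (P : PMF Ω) {X : Ω → β} {Y : Ω → γ}
    (h : ∀ ω ω', Y ω = Y ω' ↔ X ω = X ω') : ent P X = ent P Y :=
  le_antisymm (ent_le_of_factor P fun ω ω' => (h ω ω').1)
    (ent_le_of_factor P fun ω ω' => (h ω ω').2)

/-- This is log t ≤ t - 1 at t = b/a, the pointwise form of Gibbs' inequality. The hypothesis on b =
0 is absolute continuity; it cannot be dropped, as `Real.log 0 = 0`. -/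
theorem sub_le_mul_log_sub {a b : ℝ} (ha : 0 ≤ a) (hb : 0 ≤ b) (h : b = 0 → a = 0) :
    a - b ≤ a * (Real.log a - Real.log b) := by
  rcases eq_or_lt_of_le ha with rfl | ha
  · simpa using hb
  · have hb' : 0 < b := lt_of_le_of_ne hb fun h0 => ha.ne' (h h0.symm)
    have := Real.log_le_sub_one_of_pos (div_pos hb' ha)
    rw [Real.log_div hb'.ne' ha.ne'] at this
    have h2 := mul_le_mul_of_nonneg_left this ha.le
    have h3 : a * (b / a - 1) = b - a := by field_simp
    linarith

theorem eq_of_mul_log_sub_le {a b : ℝ} (ha : 0 ≤ a) (h : b = 0 → a = 0) (hb : 0 ≤ b)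
    (hle : a * (Real.log a - Real.log b) ≤ a - b) : a = b := by
  rcases eq_or_lt_of_le ha with rfl | ha
  · simp at hle; linarith
  · have hb' : 0 < b := lt_of_le_of_ne hb fun h0 => ha.ne' (h h0.symm)
    by_contra hne
    have h1 : b / a ≠ 1 := by
      rw [Ne, div_eq_one_iff_eq ha.ne']
      exact fun h => hne h.symm
    have := Real.log_lt_sub_one_of_pos (div_pos hb' ha) h1
    rw [Real.log_div hb'.ne' ha.ne'] at this
    have h2 := mul_lt_mul_of_pos_left this ha
    have h3 : a * (b / a - 1) = b - a := by field_simp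
    linarith

/-- Gibbs' inequality: the cross entropy bounds the entropy. -/
theorem ent_le_cross [Fintype β] (P : PMF Ω) (X : Ω → β) (r : β → ℝ) (hr : ∀ x, 0 ≤ r x)
    (h0 : ∀ x, r x = 0 → prob P X x = 0) (h1 : ∑ x, r x ≤ 1) :
    ent P X ≤ ∑ ω, (P ω).toReal * -Real.log (r (X ω)) := by
  rw [← sum_prob_mul P X fun x => -Real.log (r x)]
  have h2 : ∑ x, (prob P X x - r x) ≤
      ∑ x, prob P X x * (Real.log (prob P X x) - Real.log (r x)) :=
    Finset.sum_le_sum fun x _ => sub_le_mul_log_sub (prob_nonneg P X x) (hr x) (h0 x)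
  rw [Finset.sum_sub_distrib, sum_prob] at h2
  simp only [ent, Real.negMulLog, mul_sub, Finset.sum_sub_distrib, mul_neg, neg_mul,
    Finset.sum_neg_distrib] at h2 ⊢
  linarith

/-- The equality case of Gibbs' inequality. -/
theorem prob_eq_of_cross_le [Fintype β] (P : PMF Ω) (X : Ω → β) (r : β → ℝ)
    (hr : ∀ x, 0 ≤ r x) (h0 : ∀ x, r x = 0 → prob P X x = 0) (h1 : ∑ x, r x ≤ 1)
    (hle : ∑ ω, (P ω).toReal * -Real.log (r (X ω)) ≤ ent P X) (x : β) :
    prob P X x = r x := by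
  rw [← sum_prob_mul P X fun x => -Real.log (r x)] at hle
  have hterm : ∀ x ∈ Finset.univ, prob P X x - r x ≤
      prob P X x * (Real.log (prob P X x) - Real.log (r x)) := fun x _ =>
    sub_le_mul_log_sub (prob_nonneg P X x) (hr x) (h0 x)
  have hsum : ∑ x, prob P X x * (Real.log (prob P X x) - Real.log (r x)) ≤
      ∑ x, (prob P X x - r x) := by
    rw [Finset.sum_sub_distrib, sum_prob]
    simp only [ent, Real.negMulLog, mul_sub, Finset.sum_sub_distrib, mul_neg, neg_mul,
      Finset.sum_neg_distrib] at hle ⊢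
    linarith
  have heq := (Finset.sum_eq_sum_iff_of_le hterm).1
    (le_antisymm (Finset.sum_le_sum hterm) hsum) x (Finset.mem_univ x)
  exact eq_of_mul_log_sub_le (prob_nonneg P X x) (h0 x) (hr x) heq.ge

theorem ent_nonneg [Fintype β] (P : PMF Ω) (X : Ω → β) : 0 ≤ ent P X :=
  Finset.sum_nonneg fun x _ => Real.negMulLog_nonneg (prob_nonneg P X x) <| by
    rw [← sum_prob P X]
    exact Finset.single_le_sum (fun y _ => prob_nonneg P X y) (Finset.mem_univ x)

theorem ent_const [Fintype β] (P : PMF Ω) {X : Ω → β} (h : ∀ ω ω', X ω = X ω') :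
    ent P X = 0 := by
  have h1 : ∀ ω, prob P X (X ω) = 1 := by
    intro ω
    classical
    rw [prob_eq_sum, ← sum_toReal_eq_one P]
    exact Finset.sum_congr rfl fun ω' _ => if_pos (h _ _)
  rw [ent_eq_sum]
  simp [h1]

theorem ent_le_log_card [Fintype β] (P : PMF Ω) (X : Ω → β) :
    ent P X ≤ Real.log (Fintype.card β) := by
  have hne : Nonempty β := by
    by_contra h
    rw [not_nonempty_iff] at h
    have := sum_prob P X
    simp at this
  have hc : (0 : ℝ) < Fintype.card β := by exact_mod_cast Fintype.card_pos
  have := ent_le_cross P X (fun _ => (Fintype.card β : ℝ)⁻¹) (fun _ => by positivity)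
    (fun _ h => absurd h (by positivity)) (by simp)
  simpa [← Finset.sum_mul, sum_toReal_eq_one] using this

theorem ent_eq_log_card [Fintype β] (P : PMF Ω) (X : Ω → β)
    (h : ∀ x, prob P X x = (Fintype.card β : ℝ)⁻¹) : ent P X = Real.log (Fintype.card β) := by
  rw [ent_eq_sum]
  simp [h, ← Finset.sum_mul, sum_toReal_eq_one]

/-- A variable that is zero with a large probability has a small entropy. -/
theorem ent_le_log_two_add [Fintype β] [Zero β] (P : PMF Ω) (X : Ω → β) {p : ℝ}
    (hp : 1 - prob P X 0 ≤ p) :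
    ent P X ≤ Real.log 2 + p * Real.log (Fintype.card β) := by
  classical
  have hc : (1 : ℝ) ≤ Fintype.card β := by exact_mod_cast Fintype.card_pos
  have hc0 : (0 : ℝ) < Fintype.card β := by linarith
  set c : ℝ := (Fintype.card β : ℝ)
  -- The reference weights put mass 1/2 at zero and 1/(2c) at every other point. Away from zero the
  -- code length is log 2 + log c, at zero it is only log 2.
  have := ent_le_cross P X (fun x => if x = 0 then 2⁻¹ else (2 * c)⁻¹)
    (fun x => by split_ifs <;> positivity)
    (fun x h => absurd h (by split_ifs <;> positivity))
    (by
      have h1 : ∀ x : β, (if x = 0 then (2⁻¹ : ℝ) else (2 * c)⁻¹) ≤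
          (if x = 0 then 2⁻¹ else 0) + (2 * c)⁻¹ := by
        intro x
        split_ifs
        · have : 0 < (2 * c)⁻¹ := by positivity
          linarith
        · simp
      refine (Finset.sum_le_sum fun x _ => h1 x).trans ?_
      rw [Finset.sum_add_distrib]
      simp only [Finset.sum_ite_eq', Finset.mem_univ, if_true, Finset.sum_const,
        Finset.card_univ, nsmul_eq_mul]
      change 2⁻¹ + c * (2 * c)⁻¹ ≤ 1
      rw [mul_inv, mul_comm (2⁻¹ : ℝ), ← mul_assoc, mul_inv_cancel₀ hc0.ne']
      norm_num)
  refine this.trans ?_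
  rw [← sum_prob_mul P X fun x => -Real.log (if x = 0 then 2⁻¹ else (2 * c)⁻¹)]
  have h2 : ∀ x : β, -Real.log (if x = 0 then 2⁻¹ else (2 * c)⁻¹) =
      (Real.log 2 + Real.log c) - if x = 0 then Real.log c else 0 := by
    intro x
    split_ifs
    · rw [Real.log_inv]; ring
    · rw [Real.log_inv, Real.log_mul (by norm_num) hc0.ne']; ring
  simp_rw [h2, mul_sub, Finset.sum_sub_distrib, ← Finset.sum_mul, sum_prob]
  simp only [mul_ite, mul_zero, Finset.sum_ite_eq', Finset.mem_univ, if_true]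
  have := mul_le_mul_of_nonneg_right hp (Real.log_nonneg hc)
  nlinarith

theorem sum_prob_fst [Fintype β] (P : PMF Ω) (X : Ω → β) (Y : Ω → γ) (y : γ) :
    ∑ x, prob P (fun ω => (X ω, Y ω)) (x, y) = prob P Y y := by
  classical
  simp_rw [prob_eq_sum]
  rw [Finset.sum_comm]
  refine Finset.sum_congr rfl fun ω _ => ?_
  by_cases h : Y ω = y <;> simp [h]

theorem prob_pair_le_left (P : PMF Ω) (X : Ω → β) (Y : Ω → γ) (x : β) (y : γ) :
    prob P (fun ω => (X ω, Y ω)) (x, y) ≤ prob P X x := by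
  classical
  simp_rw [prob_eq_sum]
  refine Finset.sum_le_sum fun ω _ => ?_
  by_cases h : X ω = x
  · by_cases h' : Y ω = y <;> simp [h, h']
  · simp [h]

theorem prob_pair_le_right (P : PMF Ω) (X : Ω → β) (Y : Ω → γ) (x : β) (y : γ) :
    prob P (fun ω => (X ω, Y ω)) (x, y) ≤ prob P Y y := by
  classical
  simp_rw [prob_eq_sum]
  refine Finset.sum_le_sum fun ω _ => ?_
  by_cases h : Y ω = y
  · by_cases h' : X ω = x <;> simp [h, h']
  · simp [h]

/-- Submodularity of the entropy: `H(X, Y, Z) + H(Z) ≤ H(X, Z) + H(Y, Z)`. -/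
theorem ent_submodular [Fintype α] [Fintype β] [Fintype γ] (P : PMF Ω)
    (X : Ω → α) (Y : Ω → β) (Z : Ω → γ) :
    ent P (fun ω => (X ω, Y ω, Z ω)) + ent P Z ≤
      ent P (fun ω => (X ω, Z ω)) + ent P (fun ω => (Y ω, Z ω)) := by
  set pX := prob P (fun ω => (X ω, Z ω)) with hpX
  set pY := prob P (fun ω => (Y ω, Z ω)) with hpY
  set pZ := prob P Z with hpZ
  have hle : ∀ x y z, prob P (fun ω => (X ω, Y ω, Z ω)) (x, y, z) ≤ pX (x, z) := by
    intro x y z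
    classical
    rw [hpX, prob_eq_sum, prob_eq_sum]
    refine Finset.sum_le_sum fun ω _ => ?_
    by_cases h : X ω = x ∧ Z ω = z
    · by_cases h' : Y ω = y <;> simp [h.1, h.2, h']
    · have : ¬ (X ω = x ∧ Y ω = y ∧ Z ω = z) := fun h' => h ⟨h'.1, h'.2.2⟩
      simp [h, this]
  -- The reference law makes X and Y conditionally independent given Z, with the correct marginals
  -- of (X, Z) and (Y, Z).
  have hcross := ent_le_cross P (fun ω => (X ω, Y ω, Z ω))
    (fun t => pX (t.1, t.2.2) * pY t.2 / pZ t.2.2)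
    (fun t => div_nonneg (mul_nonneg (prob_nonneg ..) (prob_nonneg ..)) (prob_nonneg ..))
    (by
      rintro ⟨x, y, z⟩ h
      refine le_antisymm ?_ (prob_nonneg ..)
      rcases div_eq_zero_iff.1 h with h | h
      · rcases mul_eq_zero.1 h with h | h
        · exact (hle x y z).trans h.le
        · exact (prob_pair_le_right P X (fun ω => (Y ω, Z ω)) x (y, z)).trans h.le
      · exact ((hle x y z).trans (prob_pair_le_right P X Z x z)).trans h.le)
    (by
      rw [Fintype.sum_prod_type_right, Fintype.sum_prod_type_right, ← sum_prob P Z]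
      refine Finset.sum_le_sum fun z _ => ?_
      dsimp only
      simp_rw [← Finset.sum_div, ← Finset.sum_mul, ← Finset.mul_sum]
      rw [hpX, hpY, sum_prob_fst, sum_prob_fst]
      exact mul_self_div_self (pZ z) |>.le)
  have hsplit : ∑ ω, (P ω).toReal * -Real.log
        (pX (X ω, Z ω) * pY (Y ω, Z ω) / pZ (Z ω)) =
      ent P (fun ω => (X ω, Z ω)) + ent P (fun ω => (Y ω, Z ω)) - ent P Z := by
    rw [ent_eq_sum, ent_eq_sum, ent_eq_sum, ← Finset.sum_add_distrib, ← Finset.sum_sub_distrib]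
    refine Finset.sum_congr rfl fun ω _ => ?_
    rcases eq_or_lt_of_le (ENNReal.toReal_nonneg (a := P ω)) with h0 | h0
    · simp [← h0]
    · have h1 : pX (X ω, Z ω) ≠ 0 := (h0.trans_le (le_prob P (fun ω => (X ω, Z ω)) ω)).ne'
      have h2 : pY (Y ω, Z ω) ≠ 0 := (h0.trans_le (le_prob P (fun ω => (Y ω, Z ω)) ω)).ne'
      have h3 : pZ (Z ω) ≠ 0 := (h0.trans_le (le_prob P Z ω)).ne'
      rw [Real.log_div (mul_ne_zero h1 h2) h3, Real.log_mul h1 h2]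
      ring
  linarith

theorem sum_cross_mul [Fintype β] [Fintype γ] (P : PMF Ω) (X : Ω → β) (Y : Ω → γ) :
    ∑ ω, (P ω).toReal * -Real.log (prob P X (X ω) * prob P Y (Y ω)) = ent P X + ent P Y := by
  rw [ent_eq_sum, ent_eq_sum, ← Finset.sum_add_distrib]
  refine Finset.sum_congr rfl fun ω _ => ?_
  rcases eq_or_lt_of_le (ENNReal.toReal_nonneg (a := P ω)) with h0 | h0
  · simp [← h0]
  · rw [Real.log_mul (h0.trans_le (le_prob P X ω)).ne' (h0.trans_le (le_prob P Y ω)).ne']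
    ring

theorem ent_pair_le [Fintype β] [Fintype γ] (P : PMF Ω) (X : Ω → β) (Y : Ω → γ) :
    ent P (fun ω => (X ω, Y ω)) ≤ ent P X + ent P Y := by
  have h := ent_submodular P X Y fun _ => ()
  rw [ent_const P (X := fun _ => ()) (fun _ _ => rfl),
    ent_congr P (X := fun ω => (X ω, Y ω, ())) (Y := fun ω => (X ω, Y ω)) (by simp),
    ent_congr P (X := fun ω => (X ω, ())) (Y := X) (by simp),
    ent_congr P (X := fun ω => (Y ω, ())) (Y := Y) (by simp)] at h
  linarith

/-- Variables whose entropies add up are independent. -/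
theorem prob_pair_of_ent_add_le [Fintype β] [Fintype γ] (P : PMF Ω) (X : Ω → β) (Y : Ω → γ)
    (h : ent P X + ent P Y ≤ ent P (fun ω => (X ω, Y ω))) (x : β) (y : γ) :
    prob P (fun ω => (X ω, Y ω)) (x, y) = prob P X x * prob P Y y := by
  refine prob_eq_of_cross_le P (fun ω => (X ω, Y ω)) (fun t => prob P X t.1 * prob P Y t.2)
    (fun t => mul_nonneg (prob_nonneg ..) (prob_nonneg ..)) ?_ ?_ ?_ (x, y)
  · rintro ⟨x, y⟩ h
    refine le_antisymm ?_ (prob_nonneg ..)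
    rcases mul_eq_zero.1 h with h | h
    · exact (prob_pair_le_left P X Y x y).trans h.le
    · exact (prob_pair_le_right P X Y x y).trans h.le
  · rw [Fintype.sum_prod_type]
    simp_rw [← Finset.mul_sum, sum_prob]
    simp [sum_prob]
  · rw [sum_cross_mul]
    exact h

theorem ent_pair_of_indep [Fintype β] [Fintype γ] (P : PMF Ω) (X : Ω → β) (Y : Ω → γ)
    (h : ∀ x y, prob P (fun ω => (X ω, Y ω)) (x, y) = prob P X x * prob P Y y) :
    ent P (fun ω => (X ω, Y ω)) = ent P X + ent P Y := by
  rw [← sum_cross_mul, ent_eq_sum]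
  simp_rw [h]

/-- Summing over x shows that the factor r has to be the law of Y, so this law need not be computed
beforehand. -/
theorem ent_pair_of_factored [Fintype β] [Fintype γ] (P : PMF Ω) (X : Ω → β) (Y : Ω → γ)
    (r : γ → ℝ) (h : ∀ x y, prob P (fun ω => (X ω, Y ω)) (x, y) = prob P X x * r y) :
    ent P (fun ω => (X ω, Y ω)) = ent P X + ent P Y := by
  have hr : ∀ y, r y = prob P Y y := by
    intro y
    rw [← sum_prob_fst P X Y]
    simp_rw [h, ← Finset.sum_mul, sum_prob, one_mul]
  exact ent_pair_of_indep P X Y fun x y => by rw [h, hr]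

/-- Subadditivity of the conditional entropy for a finite family of variables. -/
theorem ent_family_sub_le {ι : Type} [DecidableEq ι] {β : ι → Type} [∀ i, Fintype (β i)]
    [Fintype γ] (P : PMF Ω) (X : (i : ι) → Ω → β i) (C : Ω → γ) (T : Finset ι) :
    ent P (fun ω => ((fun i : T => X i ω), C ω)) - ent P C ≤
      ∑ i ∈ T, (ent P (fun ω => (X i ω, C ω)) - ent P C) := by
  induction T using Finset.induction_on with
  | empty =>
    rw [Finset.sum_empty, sub_nonpos]
    refine ent_le_of_factor P fun ω ω' h => Prod.ext ?_ h
    funext i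
    exact absurd i.2 (Finset.notMem_empty _)
  | insert a T ha ih =>
    rw [Finset.sum_insert ha]
    have h1 := ent_submodular P (X a) (fun ω (i : T) => X i ω) C
    have h2 : ent P (fun ω => ((fun i : (insert a T : Finset ι) => X i ω), C ω)) ≤
        ent P (fun ω => (X a ω, (fun i : T => X i ω), C ω)) := by
      refine ent_le_of_factor P fun ω ω' h => ?_
      simp only [Prod.mk.injEq] at h
      refine Prod.ext ?_ h.2.2
      funext ⟨i, hi⟩
      rcases Finset.mem_insert.1 hi with rfl | hi
      · exact h.1
      · exact congrFun h.2.1 ⟨i, hi⟩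
    linarith

end Entropy

open scoped Classical in
/-- The truth value of a proposition, as a real number. -/
def ind (p : Prop) : ℝ := if p then 1 else 0

theorem ind_of_true {p : Prop} (h : p) : ind p = 1 := if_pos h

theorem ind_of_false {p : Prop} (h : ¬p) : ind p = 0 := if_neg h

/-! ### The joint law of a scheme, and what privacy means for it. -/

namespace Scheme

variable {F : Type} {N K : ℕ} [Field F] [Fintype F] [NeZero K]

/-- The key of the user. -/
def U (σ : Scheme F N K) (ω : σ.Outcome) : σ.Key := ω.2.2.1

theorem toReal_law_apply (σ : Scheme F N K) (w : Fin K → Fin σ.L → F) (z : σ.Noise)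
    (u : σ.Key) (θ : Fin K) :
    (σ.law (w, z, u, θ)).toReal = (Fintype.card (Fin K → Fin σ.L → F) : ℝ)⁻¹ *
      ((σ.noiseLaw z).toReal * ((σ.keyLaw u).toReal * (K : ℝ)⁻¹)) := by
  classical
  have h : σ.law (w, z, u, θ) = (Fintype.card (Fin K → Fin σ.L → F) : ENNReal)⁻¹ *
      (σ.noiseLaw z * (σ.keyLaw u * (K : ENNReal)⁻¹)) := by
    unfold law
    simp only [PMF.bind_apply, PMF.map_apply, tsum_fintype, Prod.mk.injEq,
      PMF.uniformOfFintype_apply, Fintype.card_fin]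
    rw [Finset.sum_eq_single w, Finset.sum_eq_single z, Finset.sum_eq_single u,
      Finset.sum_eq_single θ]
    · simp
    · intro b _ hb; simp [hb.symm]
    · simp
    · intro b _ hb; simp [hb.symm]
    · simp
    · intro b _ hb; simp [hb.symm]
    · simp
    · intro b _ hb; simp [hb.symm]
    · simp
  rw [h]
  simp [ENNReal.toReal_mul, ENNReal.toReal_inv]

theorem sum_law_mul (σ : Scheme F N K) (f : σ.Outcome → ℝ) :
    ∑ ω, (σ.law ω).toReal * f ω = ∑ w, ∑ z, ∑ u, ∑ θ,
      (Fintype.card (Fin K → Fin σ.L → F) : ℝ)⁻¹ *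
      ((σ.noiseLaw z).toReal * ((σ.keyLaw u).toReal * (K : ℝ)⁻¹)) * f (w, z, u, θ) := by
  simp_rw [Fintype.sum_prod_type, toReal_law_apply]

theorem prob_law (σ : Scheme F N K) {β : Type} (X : σ.Outcome → β) (x : β) :
    prob σ.law X x = ∑ w, ∑ z, ∑ u, ∑ θ,
      (Fintype.card (Fin K → Fin σ.L → F) : ℝ)⁻¹ *
      ((σ.noiseLaw z).toReal * ((σ.keyLaw u).toReal * (K : ℝ)⁻¹)) *
      ind (X (w, z, u, θ) = x) := by
  classical
  rw [prob_eq_sum, ← sum_law_mul σ fun ω => ind (X ω = x)]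
  simp [ind]

theorem prob_law_key (σ : Scheme F N K) {β : Type} (Y : σ.Key → β) (y : β) :
    prob σ.law (fun ω => Y (σ.U ω)) y = ∑ u, (σ.keyLaw u).toReal * ind (Y u = y) := by
  have hz := sum_toReal_eq_one σ.noiseLaw
  have hV : (Fintype.card (Fin K → Fin σ.L → F) : ℝ) ≠ 0 := by
    exact_mod_cast Fintype.card_ne_zero
  have hK : (K : ℝ) ≠ 0 := by exact_mod_cast NeZero.ne K
  rw [prob_law]
  simp only [U]
  set c : ℝ := (Fintype.card (Fin K → Fin σ.L → F) : ℝ)⁻¹ with hc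
  calc _ = ∑ w : Fin K → Fin σ.L → F, ∑ z, (σ.noiseLaw z).toReal * (c *
        ∑ u, (σ.keyLaw u).toReal * ind (Y u = y)) := by
        refine Finset.sum_congr rfl fun w _ => Finset.sum_congr rfl fun z _ => ?_
        rw [Finset.mul_sum, Finset.mul_sum]
        refine Finset.sum_congr rfl fun u _ => ?_
        rw [Finset.sum_const, Finset.card_univ, Fintype.card_fin, nsmul_eq_mul]
        field_simp
    _ = _ := by
        refine (Finset.sum_congr rfl fun w _ => by
          rw [← Finset.sum_mul, hz, one_mul]).trans ?_
        rw [Finset.sum_const, Finset.card_univ, nsmul_eq_mul, hc, ← mul_assoc,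
          mul_inv_cancel₀ hV, one_mul]

theorem prob_law_data (σ : Scheme F N K) {β : Type}
    (Y : (Fin K → Fin σ.L → F) → σ.Noise → β) (y : β) :
    prob σ.law (fun ω => Y ω.1 ω.2.1) y =
      ∑ w, ∑ z, (Fintype.card (Fin K → Fin σ.L → F) : ℝ)⁻¹ * (σ.noiseLaw z).toReal *
        ind (Y w z = y) := by
  have hu := sum_toReal_eq_one σ.keyLaw
  have hK : (K : ℝ) ≠ 0 := by exact_mod_cast NeZero.ne K
  rw [prob_law]
  refine Finset.sum_congr rfl fun w _ => Finset.sum_congr rfl fun z _ => ?_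
  dsimp only
  set c : ℝ := (Fintype.card (Fin K → Fin σ.L → F) : ℝ)⁻¹
  calc _ = ∑ u, (σ.keyLaw u).toReal * (c * (σ.noiseLaw z).toReal * ind (Y w z = y)) := by
        refine Finset.sum_congr rfl fun u _ => ?_
        rw [Finset.sum_const, Finset.card_univ, Fintype.card_fin, nsmul_eq_mul]
        field_simp
    _ = _ := by rw [← Finset.sum_mul, hu, one_mul]

theorem prob_key (σ : Scheme F N K) (u : σ.Key) :
    prob σ.law σ.U u = (σ.keyLaw u).toReal := by
  classical
  have h := prob_law_key σ (fun u => u) u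
  simpa [ind] using h

/-- The key is independent of the messages and the noise. -/
theorem prob_law_data_key (σ : Scheme F N K) {β : Type}
    (Y : σ.Key → (Fin K → Fin σ.L → F) → σ.Noise → β) (y : β) (u : σ.Key) :
    prob σ.law (fun ω => (Y (σ.U ω) ω.1 ω.2.1, σ.U ω)) (y, u) =
      prob σ.law (fun ω => Y u ω.1 ω.2.1) y * prob σ.law σ.U u := by
  have hK : (K : ℝ) ≠ 0 := by exact_mod_cast NeZero.ne K
  rw [prob_law_data, prob_key, prob_law]
  simp_rw [Finset.sum_mul]
  refine Finset.sum_congr rfl fun w _ => Finset.sum_congr rfl fun z _ => ?_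
  simp only [U, Prod.mk.injEq, Finset.sum_const, Finset.card_univ, Fintype.card_fin,
    nsmul_eq_mul]
  rw [Finset.sum_eq_single u]
  · simp only [and_true]
    field_simp
  · intro v _ hv
    rw [ind_of_false fun h => hv h.2]
    simp
  · simp

/-- The index of the wanted message is uniform and independent of the key. -/
theorem prob_law_index (σ : Scheme F N K) {β : Type} (Y : Fin K → σ.Key → β) (k : Fin K)
    (y : β) :
    prob σ.law (fun ω => (σ.Θ ω, Y (σ.Θ ω) (σ.U ω))) (k, y) =
      (K : ℝ)⁻¹ * prob σ.law (fun ω => Y k (σ.U ω)) y := by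
  have hK : (K : ℝ) ≠ 0 := by exact_mod_cast NeZero.ne K
  rw [prob_law, prob_law]
  simp_rw [Finset.mul_sum]
  refine Finset.sum_congr rfl fun w _ => Finset.sum_congr rfl fun z _ =>
    Finset.sum_congr rfl fun u _ => ?_
  simp only [U, Θ, Prod.mk.injEq, Finset.sum_const, Finset.card_univ, Fintype.card_fin,
    nsmul_eq_mul]
  rw [Finset.sum_eq_single k]
  · simp only [true_and]
    field_simp
  · intro v _ hv
    rw [ind_of_false fun h => hv h.1]
    simp
  · simp

theorem prob_index (σ : Scheme F N K) (k : Fin K) : prob σ.law σ.Θ k = (K : ℝ)⁻¹ := by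
  have h := prob_law_index σ (fun _ _ => ()) k ()
  rw [prob_law_key σ (fun _ => ()) ()] at h
  simp only [ind_of_true, mul_one, sum_toReal_eq_one] at h
  rw [← h, prob_law, prob_law]
  simp only [Prod.mk.injEq, and_true]

/-- The entropy of a function of the data and the key, jointly with the key. -/
theorem ent_data_key (σ : Scheme F N K) {β : Type} [Fintype β]
    (Y : σ.Key → (Fin K → Fin σ.L → F) → σ.Noise → β) :
    ent σ.law (fun ω => (Y (σ.U ω) ω.1 ω.2.1, σ.U ω)) =
      (∑ u, prob σ.law σ.U u * ent σ.law (fun ω => Y u ω.1 ω.2.1)) + ent σ.law σ.U := by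
  rw [ent, Fintype.sum_prod_type_right]
  simp_rw [prob_law_data_key, Real.negMulLog_mul, Finset.sum_add_distrib, ← Finset.sum_mul,
    ← Finset.mul_sum, sum_prob, one_mul]
  rfl

theorem ent_data_key_of_indep (σ : Scheme F N K) {β : Type} [Fintype β]
    (Y : (Fin K → Fin σ.L → F) → σ.Noise → β) :
    ent σ.law (fun ω => (Y ω.1 ω.2.1, σ.U ω)) =
      ent σ.law (fun ω => Y ω.1 ω.2.1) + ent σ.law σ.U := by
  rw [ent_data_key σ fun _ => Y, ← Finset.sum_mul, sum_prob, one_mul]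

theorem one_lt_card (F : Type) [Field F] [Fintype F] : (1 : ℝ) < Fintype.card F := by
  exact_mod_cast Fintype.one_lt_card

theorem log_card_pos (F : Type) [Field F] [Fintype F] : 0 < Real.log (Fintype.card F) :=
  Real.log_pos (one_lt_card F)

theorem mutualInfo_eq_zero_iff {Ω β γ : Type} [Fintype β] [Fintype γ] (P : PMF Ω) (X : Ω → β)
    (Y : Ω → γ) : mutualInfo (Fintype.card F) P X Y = 0 ↔
      ent P (fun ω => (X ω, Y ω)) = ent P X + ent P Y := by
  have h := log_card_pos F
  rw [mutualInfo, entropy_eq_ent_div, entropy_eq_ent_div, entropy_eq_ent_div, ← add_div,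
    ← sub_div, div_eq_zero_iff, or_iff_left h.ne', sub_eq_zero, eq_comm]

theorem condEntropy_eq_zero_iff {Ω β γ : Type} [Fintype β] [Fintype γ] (P : PMF Ω) (X : Ω → β)
    (Y : Ω → γ) : condEntropy (Fintype.card F) P X Y = 0 ↔
      ent P (fun ω => (X ω, Y ω)) = ent P Y := by
  have h := log_card_pos F
  rw [condEntropy, entropy_eq_ent_div, entropy_eq_ent_div, ← sub_div, div_eq_zero_iff,
    or_iff_left h.ne', sub_eq_zero]

/-- Privacy means that the law of the queries does not depend on the wanted message. -/
theorem privateAgainst_iff (σ : Scheme F N K) (T : Finset (Fin N)) :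
    σ.PrivateAgainst T ↔ ∀ k k' (x : T → σ.Query),
      prob σ.law (fun ω (n : T) => σ.Q k n ω) x = prob σ.law (fun ω (n : T) => σ.Q k' n ω) x := by
  have hK : (K : ℝ)⁻¹ ≠ 0 := inv_ne_zero (by exact_mod_cast NeZero.ne K)
  have key := prob_law_index σ fun k u (n : T) => σ.query k u n
  rw [PrivateAgainst, mutualInfo_eq_zero_iff]
  constructor
  · intro h k k' x
    have h1 := fun k => prob_pair_of_ent_add_le σ.law σ.Θ (fun ω (n : T) => σ.Q (σ.Θ ω) n ω)
      h.ge k x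
    have h2 := (key k x).symm.trans (h1 k)
    have h3 := (key k' x).symm.trans (h1 k')
    rw [prob_index] at h2 h3
    exact (mul_left_cancel₀ hK h2).trans (mul_left_cancel₀ hK h3).symm
  · intro h
    refine ent_pair_of_factored σ.law σ.Θ _
      (fun x => prob σ.law (fun ω (n : T) => σ.Q 0 n ω) x) fun k x => ?_
    rw [prob_index, h 0 k]
    exact key k x

end Scheme

theorem prob_congr {Ω β γ : Type} [Fintype Ω] (P : PMF Ω) {X : Ω → β} {Y : Ω → γ} {x : β}
    {y : γ} (h : ∀ ω, X ω = x ↔ Y ω = y) : prob P X x = prob P Y y := by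
  classical
  rw [prob_eq_sum, prob_eq_sum]
  simp only [h]

/-! ### The converse for the servers outside one link. -/

namespace Scheme

variable {F : Type} {N K : ℕ} [Field F] [Fintype F] [NeZero K]

/-- The storage at the servers in `X` together with the messages in `J`. -/
def side (σ : Scheme F N K) (X : Finset (Fin N)) (J : Finset (Fin K)) (ω : σ.Outcome) :
    ((n : X) → Fin (σ.storageLen n) → F) × (J → Fin σ.L → F) :=
  ((fun n => σ.S n ω), fun j => σ.W ω j)

theorem prob_query_eq (σ : Scheme F N K) {n : Fin N} (h : σ.PrivateAgainst {n}) (k k' : Fin K)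
    (x : σ.Query) : prob σ.law (σ.Q k n) x = prob σ.law (σ.Q k' n) x := by
  have key : ∀ k, prob σ.law (σ.Q k n) x =
      prob σ.law (fun ω (m : ({n} : Finset (Fin N))) => σ.Q k m ω) fun _ => x := by
    intro k
    refine prob_congr _ fun ω => ⟨fun h => ?_, fun h => congrFun h ⟨n, by simp⟩⟩
    funext ⟨m, hm⟩
    obtain rfl := Finset.mem_singleton.1 hm
    exact h
  rw [key, key]
  exact (σ.privateAgainst_iff _).1 h k k' fun _ => x

/-- The joint entropy of an answer, the key and a function of the data does not depend on the
wanted message. -/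
theorem ent_answer_data_key (σ : Scheme F N K) {n : Fin N} (h : σ.PrivateAgainst {n})
    {β : Type} [Fintype β] (Y : (Fin K → Fin σ.L → F) → σ.Noise → β) (k k' : Fin K) :
    ent σ.law (fun ω => (σ.A k n ω, Y ω.1 ω.2.1, σ.U ω)) =
      ent σ.law (fun ω => (σ.A k' n ω, Y ω.1 ω.2.1, σ.U ω)) := by
  -- Conditioning on the key turns the entropy into an average over keys of a quantity that depends
  -- on the key only through the query to n. By privacy, the law of this query is the same for all
  -- wanted messages.
  let ψ : σ.Query → ℝ := fun x =>
    ent σ.law fun ω => (σ.answer n x (σ.encode n ω.1 ω.2.1), Y ω.1 ω.2.1)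
  have key : ∀ k, ent σ.law (fun ω => (σ.A k n ω, Y ω.1 ω.2.1, σ.U ω)) =
      (∑ x, prob σ.law (σ.Q k n) x * ψ x) + ent σ.law σ.U := by
    intro k
    rw [sum_prob_mul]
    change _ = (∑ ω, (σ.law ω).toReal * ψ (σ.query k (σ.U ω) n)) + _
    rw [← sum_prob_mul σ.law σ.U fun u => ψ (σ.query k u n),
      ← σ.ent_data_key fun u w z => (σ.answer n (σ.query k u n) (σ.encode n w z), Y w z)]
    refine ent_congr _ fun ω ω' => ?_
    simp only [Prod.mk.injEq, and_assoc]
    rfl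
  rw [key k, key k']
  simp only [σ.prob_query_eq h k k']

theorem prob_messages (σ : Scheme F N K) (w : Fin K → Fin σ.L → F) :
    prob σ.law σ.W w = (Fintype.card (Fin K → Fin σ.L → F) : ℝ)⁻¹ := by
  refine (σ.prob_law_data (fun w _ => w) w).trans ?_
  simp_rw [mul_assoc, ← Finset.mul_sum, ← Finset.sum_mul, sum_toReal_eq_one, one_mul]
  rw [Finset.sum_eq_single w (fun v _ hv => ind_of_false hv) (by simp),
    ind_of_true rfl, mul_one]

/-- The cardinality bounds for J and for its complement add up to the entropy of all the messages,
which are uniform, so both are attained. -/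
theorem ent_messages (σ : Scheme F N K) (J : Finset (Fin K)) :
    ent σ.law (fun ω (j : J) => σ.W ω j) = J.card * (σ.L * Real.log (Fintype.card F)) := by
  have hcard : ∀ J : Finset (Fin K), Real.log (Fintype.card (J → Fin σ.L → F)) =
      J.card * (σ.L * Real.log (Fintype.card F)) := by
    intro J
    simp [Real.log_pow]
  have hW : ent σ.law σ.W = K * (σ.L * Real.log (Fintype.card F)) := by
    rw [ent_eq_log_card]
    · simp [Real.log_pow]
    · exact σ.prob_messages
  have h1 := ent_le_log_card σ.law (fun ω (j : J) => σ.W ω j)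
  have h2 := ent_le_log_card σ.law (fun ω (j : (Jᶜ : Finset (Fin K))) => σ.W ω j)
  have h3 : ent σ.law σ.W ≤ ent σ.law (fun ω => ((fun (j : J) => σ.W ω j),
      fun (j : (Jᶜ : Finset (Fin K))) => σ.W ω j)) := by
    refine ent_le_of_factor _ fun ω ω' h => ?_
    simp only [Prod.mk.injEq] at h
    funext j
    by_cases hj : j ∈ J
    · exact congrFun h.1 ⟨j, hj⟩
    · exact congrFun h.2 ⟨j, Finset.mem_compl.2 hj⟩
  have h4 := ent_pair_le σ.law (fun ω (j : J) => σ.W ω j)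
    (fun ω (j : (Jᶜ : Finset (Fin K))) => σ.W ω j)
  rw [hcard] at h1 h2
  have h5 : (J.card : ℝ) + (Jᶜ.card : ℝ) = K := by
    have := Finset.card_add_card_compl J
    rw [Fintype.card_fin] at this
    exact_mod_cast this
  rw [hW, ← h5] at h3
  linarith

/-- Independence of the storage from all messages passes to the messages in J by submodularity,
conditioning on these. -/
theorem ent_side (σ : Scheme F N K) {X : Finset (Fin N)} (hX : σ.SecureAgainst X)
    (J : Finset (Fin K)) : ent σ.law (σ.side X J) =
      ent σ.law (fun ω (n : X) => σ.S n ω) + J.card * (σ.L * Real.log (Fintype.card F)) := by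
  rw [← σ.ent_messages J]
  refine le_antisymm (ent_pair_le _ _ _) ?_
  have h1 := (mutualInfo_eq_zero_iff _ _ _).1 hX
  have h2 := ent_submodular σ.law σ.W (fun ω (n : X) => σ.S n ω) (fun ω (j : J) => σ.W ω j)
  have h3 : ent σ.law (fun ω => (σ.W ω, fun (n : X) => σ.S n ω)) ≤
      ent σ.law (fun ω => (σ.W ω, (fun (n : X) => σ.S n ω), fun (j : J) => σ.W ω j)) :=
    ent_le_of_factor _ fun ω ω' h => by
      simp only [Prod.mk.injEq] at h ⊢
      exact ⟨h.1, h.2.1⟩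
  have h4 : ent σ.law (fun ω => (σ.W ω, fun (j : J) => σ.W ω j)) ≤ ent σ.law σ.W :=
    ent_le_of_factor _ fun ω ω' h => by simp only [h]
  change _ ≤ ent σ.law (fun ω => ((fun (n : X) => σ.S n ω), fun (j : J) => σ.W ω j))
  linarith

theorem ent_side_key (σ : Scheme F N K) {X : Finset (Fin N)} (hX : σ.SecureAgainst X)
    (J : Finset (Fin K)) : ent σ.law (fun ω => (σ.side X J ω, σ.U ω)) =
      ent σ.law (fun ω (n : X) => σ.S n ω) + J.card * (σ.L * Real.log (Fintype.card F)) +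
        ent σ.law σ.U := by
  rw [← σ.ent_side hX]
  exact σ.ent_data_key_of_indep fun w z =>
    ((fun n : X => σ.encode n w z), fun j : J => w j)

/-- The entropy of the answers of the servers outside `X`, given the storage in `X`, the messages
in `J` and the key. -/
def residual (σ : Scheme F N K) (X : Finset (Fin N)) (k : Fin K) (J : Finset (Fin K)) : ℝ :=
  ent σ.law (fun ω => ((fun n : (Xᶜ : Finset (Fin N)) => σ.A k n ω), σ.side X J ω, σ.U ω)) -
    ent σ.law (fun ω => (σ.side X J ω, σ.U ω))

theorem residual_nonneg (σ : Scheme F N K) (X : Finset (Fin N)) (k : Fin K)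
    (J : Finset (Fin K)) : 0 ≤ σ.residual X k J :=
  sub_nonneg.2 <| ent_le_of_factor _ fun ω ω' h => by
    simp only [Prod.mk.injEq] at h ⊢
    exact h.2

/-- The storage in X and the key determine the answers in X and all queries. With the answers from
outside X they therefore determine message k, and adjoining it leaves the joint entropy unchanged.
The conditioning term, however, grows by the full entropy of a message, by security. -/
theorem add_residual_insert_le (σ : Scheme F N K) {X : Finset (Fin N)}
    (hX : σ.SecureAgainst X) (hD : σ.Decodable) {k : Fin K} {J : Finset (Fin K)} (hk : k ∉ J) :
    σ.L * Real.log (Fintype.card F) + σ.residual X k (insert k J) ≤ σ.residual X k J := by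
  rw [residual, residual, σ.ent_side_key hX, σ.ent_side_key hX, Finset.card_insert_of_notMem hk]
  have hd := (condEntropy_eq_zero_iff _ _ _).1 (hD k)
  let D : σ.Outcome → _ := fun ω => ((fun n => σ.A k n ω), (fun n => σ.Q k n ω))
  let E : σ.Outcome → _ := fun ω =>
    ((fun n : (Xᶜ : Finset (Fin N)) => σ.A k n ω), σ.side X J ω, σ.U ω)
  have hsub := ent_submodular σ.law (fun ω => σ.W ω k) E D
  have hED : ent σ.law (fun ω => (E ω, D ω)) ≤ ent σ.law E := by
    refine ent_le_of_factor _ fun ω ω' h => Prod.ext h ?_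
    simp only [E, side, Prod.mk.injEq] at h
    obtain ⟨hA, ⟨hS, -⟩, hU⟩ := h
    have hQ : ∀ n, σ.Q k n ω = σ.Q k n ω' := fun n => congrArg (fun u => σ.query k u n) hU
    refine Prod.ext (funext fun n => ?_) (funext hQ)
    by_cases hn : n ∈ X
    · have : σ.S n ω = σ.S n ω' := congrFun hS ⟨n, hn⟩
      simp only [D, A, this, hQ n]
    · exact congrFun hA ⟨n, Finset.mem_compl.2 hn⟩
  have hins : ent σ.law (fun ω => ((fun n : (Xᶜ : Finset (Fin N)) => σ.A k n ω),
        σ.side X (insert k J) ω, σ.U ω)) ≤ ent σ.law (fun ω => (σ.W ω k, E ω, D ω)) := by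
    refine ent_le_of_factor _ fun ω ω' h => ?_
    simp only [E, side, Prod.mk.injEq] at h ⊢
    obtain ⟨hW, ⟨hA, ⟨hS, hJ⟩, hU⟩, -⟩ := h
    refine ⟨hA, ⟨hS, funext fun ⟨j, hj⟩ => ?_⟩, hU⟩
    rcases Finset.mem_insert.1 hj with rfl | hj
    · exact hW
    · exact congrFun hJ ⟨j, hj⟩
  push_cast
  change ent σ.law (fun ω => (σ.W ω k, D ω)) = ent σ.law D at hd
  change _ ≤ ent σ.law E - _
  linarith

/-- The residual is at most the sum of its single-server contributions. By privacy, each of these is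
the same when k is wanted instead of k', and it is then bounded by the whole residual for k. -/
theorem residual_le_card_mul (σ : Scheme F N K) {X : Finset (Fin N)}
    (hP : ∀ n, σ.PrivateAgainst {n}) (k k' : Fin K) (J : Finset (Fin K)) :
    σ.residual X k' J ≤ Xᶜ.card * σ.residual X k J := by
  refine (ent_family_sub_le σ.law (fun n => σ.A k' n) (fun ω => (σ.side X J ω, σ.U ω))
    Xᶜ).trans ?_
  rw [← nsmul_eq_mul]
  refine Finset.sum_le_card_nsmul _ _ _ fun n hn => ?_
  have h := σ.ent_answer_data_key (hP n)
    (fun w z => ((fun n : X => σ.encode n w z), fun j : J => w j)) k' k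
  change ent σ.law (fun ω => (σ.A k' n ω, σ.side X J ω, σ.U ω)) =
    ent σ.law (fun ω => (σ.A k n ω, σ.side X J ω, σ.U ω)) at h
  rw [h, residual]
  refine sub_le_sub_right (ent_le_of_factor _ fun ω ω' h => ?_) _
  simp only [Prod.mk.injEq] at h ⊢
  exact ⟨congrFun h.1 ⟨n, hn⟩, h.2⟩

/-- Induction on the number j + 1 of messages outside J, wanting a new message k' at each step: the
drop by one message and the factor 1/g reproduce the recursion of the geometric sum. -/
theorem geom_sum_le_residual (σ : Scheme F N K) {X : Finset (Fin N)}
    (hX : σ.SecureAgainst X) (hD : σ.Decodable) (hP : ∀ n, σ.PrivateAgainst {n})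
    (hg : 0 < Xᶜ.card) (j : ℕ) : ∀ (k : Fin K) (J : Finset (Fin K)), k ∉ J →
      J.card + (j + 1) = K → σ.L * Real.log (Fintype.card F) *
        ∑ i ∈ Finset.range (j + 1), (1 / (Xᶜ.card : ℝ)) ^ i ≤ σ.residual X k J := by
  have hg' : (0 : ℝ) < Xᶜ.card := by exact_mod_cast hg
  induction j with
  | zero =>
    intro k J hk _
    have h1 := σ.add_residual_insert_le hX hD hk
    have h2 := σ.residual_nonneg X k (insert k J)
    simp only [zero_add, Finset.range_one, Finset.sum_singleton, pow_zero, mul_one]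
    linarith
  | succ j ih =>
    intro k J hk hJ
    have h1 := σ.add_residual_insert_le hX hD hk
    have hc : (insert k J).card + (j + 1) = K := by
      rw [Finset.card_insert_of_notMem hk]; omega
    obtain ⟨k', hk'⟩ : ∃ k', k' ∉ insert k J := by
      by_contra! h
      have := Finset.card_eq_iff_eq_univ (insert k J) |>.2 (Finset.eq_univ_iff_forall.2 h)
      rw [Fintype.card_fin] at this
      omega
    have h2 := ih k' _ hk' hc
    have h3 := σ.residual_le_card_mul (X := X) hP k k' (insert k J)
    rw [geom_sum_succ, mul_add, mul_one, mul_left_comm, add_comm]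
    refine le_trans (add_le_add_right ?_ _) h1
    simp only [one_div] at h2 ⊢
    rw [inv_mul_le_iff₀ hg']
    exact h2.trans h3

/-- The converse bound for the servers outside a link. -/
theorem geom_sum_le_sum_ent (σ : Scheme F N K) {X : Finset (Fin N)}
    (hX : σ.SecureAgainst X) (hD : σ.Decodable) (hP : ∀ n, σ.PrivateAgainst {n})
    (hg : 0 < Xᶜ.card) (k : Fin K) :
    σ.L * ∑ i ∈ Finset.range K, (1 / (Xᶜ.card : ℝ)) ^ i ≤
      ∑ n ∈ Xᶜ, entropy (Fintype.card F) σ.law (σ.A k n) := by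
  have hq := log_card_pos F
  obtain ⟨j, hj⟩ := Nat.exists_eq_succ_of_ne_zero (NeZero.ne K)
  have h1 := σ.geom_sum_le_residual hX hD hP hg j k ∅ (Finset.notMem_empty _) (by simp [hj])
  have h2 := ent_family_sub_le σ.law (fun n => σ.A k n) (fun ω => (σ.side X ∅ ω, σ.U ω)) Xᶜ
  have h3 : ∑ n ∈ Xᶜ, (ent σ.law (fun ω => (σ.A k n ω, σ.side X ∅ ω, σ.U ω)) -
      ent σ.law (fun ω => (σ.side X ∅ ω, σ.U ω))) ≤ ∑ n ∈ Xᶜ, ent σ.law (σ.A k n) :=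
    Finset.sum_le_sum fun n _ => by
      have := ent_pair_le σ.law (σ.A k n) (fun ω => (σ.side X ∅ ω, σ.U ω))
      linarith
  simp_rw [entropy_eq_ent_div]
  rw [← Finset.sum_div, le_div_iff₀ hq, mul_right_comm]
  have h4 := h1.trans (h2.trans h3)
  rwa [← Nat.succ_eq_add_one, ← hj] at h4

end Scheme

/-! ### Sufficient conditions for security, privacy and decodability. -/

namespace Scheme

variable {F : Type} {N K : ℕ} [Field F] [Fintype F] [NeZero K]

/-- Storage is secure if any two databases can be exchanged, unnoticed by the servers in `X`, by
a measure-preserving change of the noise. -/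
theorem secureAgainst_of_equiv (σ : Scheme F N K) (X : Finset (Fin N))
    (h : ∀ w, ∃ e : σ.Noise ≃ σ.Noise, (∀ z, σ.noiseLaw (e z) = σ.noiseLaw z) ∧
      ∀ z, ∀ n ∈ X, σ.encode n w z = σ.encode n 0 (e z)) : σ.SecureAgainst X := by
  rw [SecureAgainst, mutualInfo_eq_zero_iff]
  -- The candidate for the law of the storage is its law for the zero database.
  refine ent_pair_of_factored _ _ _ (fun s => ∑ z, (σ.noiseLaw z).toReal *
    ind ((fun n : X => σ.encode n 0 z) = s)) fun w s => ?_
  obtain ⟨e, he, hz⟩ := h w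
  rw [prob_messages]
  refine (σ.prob_law_data (fun w z => (w, fun n : X => σ.encode n w z)) (w, s)).trans ?_
  rw [Finset.sum_eq_single w]
  · rw [← Equiv.sum_comp e fun z => (σ.noiseLaw z).toReal *
      ind ((fun n : X => σ.encode n 0 z) = s), Finset.mul_sum]
    refine Finset.sum_congr rfl fun z _ => ?_
    have : (fun n : X => σ.encode n w z) = fun n : X => σ.encode n 0 (e z) :=
      funext fun n => hz z n n.2
    rw [he, this, Prod.mk.injEq, mul_assoc]
    simp only [true_and]
  · intro v _ hv
    refine Finset.sum_eq_zero fun z _ => ?_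
    rw [ind_of_false fun h => hv (Prod.ext_iff.1 h).1, mul_zero]
  · simp

/-- Queries are private if a change of the wanted message can be compensated, for the servers in
`T`, by a measure-preserving change of the key. -/
theorem privateAgainst_of_equiv (σ : Scheme F N K) (T : Finset (Fin N))
    (h : ∀ k k', ∃ e : σ.Key ≃ σ.Key, (∀ u, σ.keyLaw (e u) = σ.keyLaw u) ∧
      ∀ u, ∀ n ∈ T, σ.query k u n = σ.query k' (e u) n) : σ.PrivateAgainst T := by
  rw [privateAgainst_iff]
  intro k k' x
  obtain ⟨e, he, hu⟩ := h k k'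
  refine (σ.prob_law_key (fun u (n : T) => σ.query k u n) x).trans
    (Eq.trans ?_ (σ.prob_law_key (fun u (n : T) => σ.query k' u n) x).symm)
  rw [← Equiv.sum_comp e fun u => (σ.keyLaw u).toReal * ind ((fun n : T => σ.query k' u n) = x)]
  refine Finset.sum_congr rfl fun u _ => ?_
  have : (fun n : T => σ.query k u n) = fun n : T => σ.query k' (e u) n :=
    funext fun n => hu u n n.2
  rw [he, this]

theorem decodable_of_forall (σ : Scheme F N K)
    (h : ∀ k (ω ω' : σ.Outcome), (∀ n, σ.A k n ω = σ.A k n ω') →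
      (∀ n, σ.Q k n ω = σ.Q k n ω') → σ.W ω k = σ.W ω' k) : σ.Decodable := by
  intro k
  rw [condEntropy_eq_zero_iff]
  refine ent_congr _ fun ω ω' => ⟨fun hD => ?_, fun hD => (Prod.ext_iff.1 hD).2⟩
  refine Prod.ext (h k ω ω' (fun n => ?_) fun n => ?_) hD
  · exact congrFun (Prod.ext_iff.1 hD).1 n
  · exact congrFun (Prod.ext_iff.1 hD).2 n

end Scheme

/-! ### From replicated servers to groups: answer costs and secret sharing. -/

theorem entropy_le_length {F Ω : Type} [Field F] [Fintype F] [Fintype Ω] (P : PMF Ω) {d : ℕ}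
    (X : Ω → Fin d → F) : entropy (Fintype.card F) P X ≤ d := by
  rw [entropy_eq_ent_div, div_le_iff₀ (Scheme.log_card_pos F)]
  refine (ent_le_log_card P X).trans (le_of_eq ?_)
  simp [Real.log_pow]

/-- Recording whether the answer vanishes costs at most log 2 ≤ log q, that is, one symbol. -/
theorem entropy_le_one_add {F Ω : Type} [Field F] [Fintype F] [Fintype Ω] (P : PMF Ω) {d : ℕ}
    (X : Ω → Fin d → F) {p : ℝ} (hp : 1 - prob P X 0 ≤ p) :
    entropy (Fintype.card F) P X ≤ 1 + p * d := by
  have hq := Scheme.log_card_pos F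
  rw [entropy_eq_ent_div, div_le_iff₀ hq]
  refine (ent_le_log_two_add P X hp).trans ?_
  have h2 : Real.log 2 ≤ Real.log (Fintype.card F) :=
    Real.log_le_log (by norm_num) (by exact_mod_cast Fintype.one_lt_card (α := F))
  simp only [Fintype.card_fun, Fintype.card_fin, Nat.cast_pow, Real.log_pow]
  linarith

/-- A retrieval scheme for replicated servers, indexed by `ι`, whose answers are additive in the
messages. The key is uniform. -/
structure LinearPIR (F : Type) [Field F] (ι : Type) (K : ℕ) where
  L : ℕ
  L_pos : 0 < L
  Key : Type
  [fintypeKey : Fintype Key]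
  [nonemptyKey : Nonempty Key]
  Query : Type
  [fintypeQuery : Fintype Query]
  len : ℕ
  query : Fin K → Key → ι → Query
  answer : Query → (Fin K → Fin L → F) →+ (Fin len → F)
  private_single : ∀ i k k', ∃ e : Key ≃ Key, ∀ u, query k u i = query k' (e u) i
  decodable : ∀ k u w w', (∀ i, answer (query k u i) w = answer (query k u i) w') → w k = w' k

attribute [instance] LinearPIR.fintypeKey LinearPIR.nonemptyKey LinearPIR.fintypeQuery

/-- Databases as vectors. -/
def vecEquiv (F : Type) (K L : ℕ) : (Fin K → Fin L → F) ≃ (Fin (K * L) → F) :=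
  (Equiv.curry (Fin K) (Fin L) F).symm.trans (Equiv.arrowCongr finProdFinEquiv (Equiv.refl F))

section Share

variable {N : ℕ} {ι V : Type} [AddCommGroup V] [DecidableEq ι]

/-- The members of the group `i`, where `c` assigns a group to every server that is in use. -/
def members (c : Fin N → Option ι) (i : ι) : Finset (Fin N) :=
  Finset.univ.filter fun n => c n = some i

/-- Additive secret sharing within each group: the shares of a group add up to `w`. -/
def share (c : Fin N → Option ι) (lead : ι → Fin N) (n : Fin N) (w : V) (z : Fin N → V) : V :=
  (c n).elim (z n) fun i =>
    if n = lead i then w - ∑ m ∈ (members c i).erase (lead i), z m else z n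

theorem sum_share {c : Fin N → Option ι} {lead : ι → Fin N} (hlead : ∀ i, c (lead i) = some i)
    (i : ι) (w : V) (z : Fin N → V) : ∑ n ∈ members c i, share c lead n w z = w := by
  have hmem : lead i ∈ members c i := by simp [members, hlead]
  rw [← Finset.add_sum_erase _ _ hmem]
  have h1 : share c lead (lead i) w z = w - ∑ m ∈ (members c i).erase (lead i), z m := by
    simp [share, hlead]
  have h2 : ∑ n ∈ (members c i).erase (lead i), share c lead n w z =
      ∑ m ∈ (members c i).erase (lead i), z m := by
    refine Finset.sum_congr rfl fun n hn => ?_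
    obtain ⟨hne, hn⟩ := Finset.mem_erase.1 hn
    have hc : c n = some i := by simpa [members] using hn
    simp [share, hc, hne]
  rw [h1, h2, sub_add_cancel]

/-- A change of the shared value is invisible to servers that miss a member `x i` of every
group. -/
theorem share_add {c : Fin N → Option ι} {lead x : ι → Fin N}
    (hx : ∀ i, c (x i) = some i) {n : Fin N}
    (hn : ∀ i, n ≠ x i) (w w' : V) (z : Fin N → V) :
    share c lead n w z = share c lead n w'
      (z + fun m => (c m).elim 0 fun i => if m = x i then w' - w else 0) := by
  rcases hc : c n with _ | i
  · simp [share, hc]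
  · simp only [share, hc, Option.elim_some, Pi.add_apply]
    split_ifs with h h'
    · have hxm : x i ∈ (members c i).erase (lead i) := by
        rw [Finset.mem_erase]
        exact ⟨fun h' => hn i (h.trans h'.symm), by simp [members, hx]⟩
      have : ∑ m ∈ (members c i).erase (lead i),
          (c m).elim 0 (fun i => if m = x i then w' - w else 0) = w' - w := by
        rw [Finset.sum_eq_single_of_mem _ hxm]
        · simp [hx]
        · intro m hm hne
          have : c m = some i := by
            simpa [members] using (Finset.mem_erase.1 hm).2
          simp [this, hne]
      rw [Finset.sum_add_distrib, this]
      abel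
    · exact absurd h' (hn i)
    · simp

end Share

namespace LinearPIR

variable {F : Type} {N K : ℕ} {ι : Type} [Field F] [Fintype F] [DecidableEq ι]

/-- Every replicated server is replaced by a group of servers among which the database is
shared, and which receive the same query. -/
abbrev scheme (π : LinearPIR F ι K) (c : Fin N → Option ι) (lead : ι → Fin N) : Scheme F N K where
  L := π.L
  L_pos := π.L_pos
  Noise := Fin N → Fin K → Fin π.L → F
  noiseLaw := PMF.uniformOfFintype _
  Key := π.Key
  keyLaw := PMF.uniformOfFintype _
  Query := Option π.Query
  storageLen _ := K * π.L
  answerLen _ := π.len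
  encode n w z := vecEquiv F K π.L (share c lead n w z)
  query k u n := (c n).map (π.query k u)
  answer _ q s := q.elim 0 fun q => π.answer q ((vecEquiv F K π.L).symm s)

theorem scheme_answer (π : LinearPIR F ι K) (c : Fin N → Option ι) (lead : ι → Fin N)
    (k : Fin K) (n : Fin N) {i : ι} (hn : c n = some i) (ω : (π.scheme c lead).Outcome) :
    (π.scheme c lead).A k n ω =
      π.answer (π.query k ω.2.2.1 i) (share c lead n ω.1 ω.2.1) := by
  simp [Scheme.A, Scheme.Q, Scheme.S, scheme, hn]

variable [NeZero K]

theorem scheme_secureAgainst (π : LinearPIR F ι K) (c : Fin N → Option ι) (lead : ι → Fin N)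
    (X : Finset (Fin N)) (hX : ∀ i, ∃ n, c n = some i ∧ n ∉ X) :
    (π.scheme c lead).SecureAgainst X := by
  choose x hx hxX using hX
  refine Scheme.secureAgainst_of_equiv _ _ fun w => ?_
  refine ⟨Equiv.addRight fun m => (c m).elim 0 fun i => if m = x i then (0 : Fin K → Fin π.L → F) - w else 0,
    fun z => ?_, fun z n hn => ?_⟩
  · simp [scheme, PMF.uniformOfFintype_apply]
  · exact congrArg (vecEquiv F K π.L)
      (share_add hx (fun i h => hxX i (h ▸ hn)) w 0 z)

theorem scheme_privateAgainst (π : LinearPIR F ι K) (c : Fin N → Option ι) (lead : ι → Fin N)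
    (T : Finset (Fin N)) (o : Option ι) (hT : ∀ n ∈ T, c n = o) :
    (π.scheme c lead).PrivateAgainst T := by
  refine Scheme.privateAgainst_of_equiv _ _ fun k k' => ?_
  cases o with
  | none =>
    refine ⟨Equiv.refl _, fun _ => rfl, fun u n hn => ?_⟩
    simp [scheme, hT n hn]
  | some i =>
    obtain ⟨e, he⟩ := π.private_single i k k'
    refine ⟨e, fun u => by simp [scheme, PMF.uniformOfFintype_apply], fun u n hn => ?_⟩
    simp [scheme, hT n hn, he]

/-- Additivity of the answers is used here: the sum over a group is the answer to the sum of the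
shares, which is the database. -/
theorem scheme_decodable (π : LinearPIR F ι K) (c : Fin N → Option ι) (lead : ι → Fin N)
    (hlead : ∀ i, c (lead i) = some i) : (π.scheme c lead).Decodable := by
  refine Scheme.decodable_of_forall _ fun k ω ω' hA hQ => ?_
  refine π.decodable k ω.2.2.1 ω.1 ω'.1 fun i => ?_
  have hq : π.query k ω.2.2.1 i = π.query k ω'.2.2.1 i := by
    have := hQ (lead i)
    simpa [Scheme.Q, scheme, hlead] using this
  rw [← sum_share hlead i ω.1 ω.2.1, ← sum_share hlead i ω'.1 ω'.2.1, map_sum, map_sum]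
  refine Finset.sum_congr rfl fun n hn => ?_
  have hc : c n = some i := by simpa [members] using hn
  have := hA n
  rw [π.scheme_answer c lead k n hc, π.scheme_answer c lead k n hc, ← hq] at this
  exact this

theorem scheme_isAdmissible (π : LinearPIR F ι K) (c : Fin N → Option ι) (lead : ι → Fin N)
    (hlead : ∀ i, c (lead i) = some i) {𝒳 𝒯 : Finset (Finset (Fin N))}
    (hcard : ∀ i, 2 ≤ (members c i).card) (h𝒳 : ∀ X ∈ 𝒳, ∀ i, ∃ n, c n = some i ∧ n ∉ X)
    (h𝒯 : ∀ T ∈ 𝒯, ∃ i, ∀ n ∈ T, c n = some i) : (π.scheme c lead).IsAdmissible 𝒳 𝒯 where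
  secure_single n := π.scheme_secureAgainst c lead _ fun i => by
    obtain ⟨m, hm, hne⟩ := Finset.exists_mem_ne (hcard i) n
    exact ⟨m, by simpa [members] using hm, by simpa using hne⟩
  secure_link X hX := π.scheme_secureAgainst c lead X (h𝒳 X hX)
  private_single n := π.scheme_privateAgainst c lead _ (c n) (by simp)
  private_collusion T hT := by
    obtain ⟨i, hi⟩ := h𝒯 T hT
    exact π.scheme_privateAgainst c lead T (some i) hi
  decodable := π.scheme_decodable c lead hlead

/-- The download cost, from bounds for the answers of each group. -/
theorem scheme_download_le [Fintype ι] (π : LinearPIR F ι K) (c : Fin N → Option ι)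
    (lead : ι → Fin N) (k : Fin K) (s : ℕ) (hs : ∀ i, (members c i).card = s) (b : ι → ℝ)
    (hb : ∀ i n, c n = some i →
      entropy (Fintype.card F) (π.scheme c lead).law ((π.scheme c lead).A k n) ≤ b i) :
    ∑ n, entropy (Fintype.card F) (π.scheme c lead).law ((π.scheme c lead).A k n) ≤
      s * ∑ i, b i := by
  rw [← Finset.sum_fiberwise Finset.univ c, Fintype.sum_option, Finset.mul_sum]
  have h0 : ∑ n with c n = none,
      entropy (Fintype.card F) (π.scheme c lead).law ((π.scheme c lead).A k n) = 0 := by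
    refine Finset.sum_eq_zero fun n hn => ?_
    have hn : c n = none := by simpa using hn
    rw [entropy_eq_ent_div, ent_const, zero_div]
    intro ω ω'
    simp [Scheme.A, Scheme.Q, scheme, hn]
  rw [h0, zero_add]
  refine Finset.sum_le_sum fun i _ => ?_
  rw [← hs i, ← nsmul_eq_mul]
  exact Finset.sum_le_card_nsmul _ _ _ fun n hn => hb i n (by simpa using hn)

/-- Answers to a null query, to which every server replies by zero, cost little. -/
theorem scheme_entropy_le_one_add (π : LinearPIR F ι K) (c : Fin N → Option ι)
    (lead : ι → Fin N) (k : Fin K) {i : ι} {n : Fin N} (hn : c n = some i) (q₀ : π.Query)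
    (h0 : π.answer q₀ = 0) (S : Finset π.Key) (hS : ∀ u ∈ S, π.query k u i = q₀) :
    entropy (Fintype.card F) (π.scheme c lead).law ((π.scheme c lead).A k n) ≤
      1 + (1 - S.card / Fintype.card π.Key) * π.len := by
  refine entropy_le_one_add _ _ (sub_le_sub_left ?_ 1)
  -- The event that the key lies in S is treated as a `Prop`-valued variable that takes the value
  -- `True`.
  have h1 := (π.scheme c lead).prob_law_key (fun u => u ∈ S) True
  have h2 : prob (π.scheme c lead).law (fun ω => (π.scheme c lead).U ω ∈ S) True ≤
      prob (π.scheme c lead).law ((π.scheme c lead).A k n) 0 := by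
    classical
    rw [prob_eq_sum, prob_eq_sum]
    refine Finset.sum_le_sum fun ω _ => ?_
    by_cases h : (π.scheme c lead).U ω ∈ S
    · have hA : (π.scheme c lead).A k n ω = 0 := by
        rw [π.scheme_answer c lead k n hn]
        have := hS _ h
        simp only [Scheme.U] at this
        rw [this, h0]
        rfl
      rw [if_pos (by simpa using h), if_pos hA]
    · rw [if_neg (by simpa using h)]
      split_ifs <;> simp
  refine le_trans (le_of_eq ?_) (h1.symm.le.trans h2)
  have h3 : ∀ u : π.Key, ((π.scheme c lead).keyLaw u).toReal = (Fintype.card π.Key : ℝ)⁻¹ := by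
    intro u
    simp [scheme, PMF.uniformOfFintype_apply]
  change _ = ∑ u : π.Key, ((π.scheme c lead).keyLaw u).toReal * ind ((u ∈ S) = True)
  classical
  simp_rw [h3, ← Finset.mul_sum, ind, eq_iff_iff, iff_true]
  simp [div_eq_inv_mul]

end LinearPIR

/-! ### Retrieval schemes for replicated servers and their cost. -/

namespace LinearPIR

/-- With a single server, the whole database is downloaded. -/
def trivialPIR (F : Type) [Field F] (ι : Type) [Nonempty ι] (K : ℕ) : LinearPIR F ι K where
  L := 1
  L_pos := one_pos
  Key := Unit
  Query := Unit
  len := K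
  query _ _ _ := ()
  answer _ :=
    { toFun := fun w k => w k 0
      map_zero' := rfl
      map_add' := fun _ _ => rfl }
  private_single _ _ _ := ⟨Equiv.refl _, fun _ => rfl⟩
  decodable k u w w' h := by
    have := congrFun (h (Classical.arbitrary ι)) k
    funext t
    rw [Subsingleton.elim t 0]
    exact this

section Cyclic

theorem sum_add_single {K g : ℕ} (u : Fin K → ZMod g) (k : Fin K) (a : ZMod g) :
    ∑ j, (u + Pi.single k a : Fin K → ZMod g) j = ∑ j, u j + a := by
  simp [Finset.sum_add_distrib]

variable {F : Type} [Field F] {g ℓ : ℕ} [NeZero g]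

/-- The symbols of a message consist of a packet of length `ℓ` for each nonzero residue. -/
def packetEquiv (g ℓ : ℕ) [NeZero g] : {x : ZMod g // x ≠ 0} × Fin ℓ ≃ Fin ((g - 1) * ℓ) :=
  Fintype.equivFinOfCardEq (by
    rw [Fintype.card_prod, Fintype.card_fin, Fintype.card_subtype_compl]
    simp [ZMod.card])

/-- The packet of a message at a residue, where the packet at `0` vanishes. -/
def packet (v : Fin ((g - 1) * ℓ) → F) (x : ZMod g) (t : Fin ℓ) : F :=
  if h : x ≠ 0 then v (packetEquiv g ℓ (⟨x, h⟩, t)) else 0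

theorem packet_zero_right (v : Fin ((g - 1) * ℓ) → F) (t : Fin ℓ) : packet v (0 : ZMod g) t = 0 :=
  dif_neg (by simp)

theorem packet_add (v v' : Fin ((g - 1) * ℓ) → F) (x : ZMod g) (t : Fin ℓ) :
    packet (v + v') x t = packet v x t + packet v' x t := by
  unfold packet
  split_ifs <;> simp

theorem eq_of_packet_eq {v v' : Fin ((g - 1) * ℓ) → F}
    (h : ∀ (x : ZMod g) t, packet v x t = packet v' x t) : v = v' := by
  funext s
  obtain ⟨⟨⟨x, hx⟩, t⟩, rfl⟩ := (packetEquiv g ℓ).surjective s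
  have := h x t
  rwa [packet, packet, dif_pos hx, dif_pos hx] at this

/-- The sum of the packets of all messages at the queried residues. -/
def packetSum (F : Type) [Field F] (g ℓ K : ℕ) [NeZero g] (q : Fin K → ZMod g) :
    (Fin K → Fin ((g - 1) * ℓ) → F) →+ (Fin ℓ → F) where
  toFun w t := ∑ k, packet (w k) (q k) t
  map_zero' := by
    funext t
    refine Finset.sum_eq_zero fun k _ => ?_
    simp [packet]
  map_add' w w' := by
    funext t
    simp [packet_add, Finset.sum_add_distrib]

theorem packetSum_zero (F : Type) [Field F] (g ℓ K : ℕ) [NeZero g] :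
    packetSum F g ℓ K 0 = 0 := by
  ext w t
  simp [packetSum, packet_zero_right]

/-- The query of the server `i`: the residues of the unwanted messages are those of the key, and
all the residues add up to `i`. -/
def cyclicQuery {K g : ℕ} (k : Fin K) (u : Fin K → ZMod g) (i : ZMod g) : Fin K → ZMod g :=
  u + Pi.single k (i - ∑ j, u j)

/-- The correction i - ∑ u is added at k and subtracted at k'. This preserves the sum of the key,
hence the correction itself, so exchanging k and k' gives the inverse. -/
theorem exists_equiv_cyclicQuery {K g : ℕ} (i : ZMod g) (k k' : Fin K) :
    ∃ e : (Fin K → ZMod g) ≃ (Fin K → ZMod g),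
      ∀ u, cyclicQuery k u i = cyclicQuery k' (e u) i := by
  have hsum : ∀ (a b : Fin K) (u : Fin K → ZMod g) (x : ZMod g),
      ∑ j, (u + Pi.single a x + Pi.single b (-x) : Fin K → ZMod g) j = ∑ j, u j := by
    intro a b u x
    rw [sum_add_single, sum_add_single]
    ring
  have hcancel : ∀ (b : Fin K) (x : ZMod g),
      (Pi.single b (-x) : Fin K → ZMod g) = -Pi.single b x := fun b x => Pi.single_neg ..
  refine ⟨⟨fun u => u + Pi.single k (i - ∑ j, u j) + Pi.single k' (-(i - ∑ j, u j)),
    fun u => u + Pi.single k' (i - ∑ j, u j) + Pi.single k (-(i - ∑ j, u j)), fun u => ?_,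
    fun u => ?_⟩, fun u => ?_⟩
  · dsimp only
    rw [hsum, hcancel, hcancel]
    abel
  · dsimp only
    rw [hsum, hcancel, hcancel]
    abel
  · dsimp only [cyclicQuery, Equiv.coe_fn_mk]
    rw [hsum, hcancel]
    abel

/-- All servers add the same interference from the unwanted messages, while the residue of the
wanted one runs through all of `ZMod g`. At residue 0 the packet vanishes, and the answer is the
interference alone. -/
theorem eq_of_packetSum_cyclicQuery_eq {K : ℕ} (k : Fin K) (u : Fin K → ZMod g)
    (w w' : Fin K → Fin ((g - 1) * ℓ) → F)
    (h : ∀ i, packetSum F g ℓ K (cyclicQuery k u i) w =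
      packetSum F g ℓ K (cyclicQuery k u i) w') : w k = w' k := by
  have hsplit : ∀ (v : Fin K → Fin ((g - 1) * ℓ) → F) (x : ZMod g) (t : Fin ℓ),
      -- The server index is solved from the condition that the residue queried for message k be x.
      packetSum F g ℓ K (cyclicQuery k u (x + ∑ j, u j - u k)) v t =
        packet (v k) x t + ∑ j ∈ Finset.univ.erase k, packet (v j) (u j) t := by
    intro v x t
    change ∑ j, packet (v j) (cyclicQuery k u (x + ∑ j, u j - u k) j) t = _
    rw [← Finset.add_sum_erase _ _ (Finset.mem_univ k)]
    congr 1
    · congr 1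
      simp only [cyclicQuery, Pi.add_apply, Pi.single_eq_same]
      ring
    · refine Finset.sum_congr rfl fun j hj => ?_
      simp [cyclicQuery, Pi.single_eq_of_ne (Finset.ne_of_mem_erase hj)]
  have key : ∀ (x : ZMod g) t,
      packet (w k) x t + ∑ j ∈ Finset.univ.erase k, packet (w j) (u j) t =
        packet (w' k) x t + ∑ j ∈ Finset.univ.erase k, packet (w' j) (u j) t := by
    intro x t
    rw [← hsplit, ← hsplit, h]
  refine eq_of_packet_eq fun x t => ?_
  have h0 := key 0 t
  rw [packet_zero_right, packet_zero_right, zero_add, zero_add] at h0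
  have hx := key x t
  rw [h0] at hx
  exact add_right_cancel hx

/-- The capacity-achieving scheme with message length `g - 1`, applied to packets. -/
def cyclicPIR (F : Type) [Field F] (g ℓ K : ℕ) [NeZero g] (hg : 2 ≤ g) (hℓ : 0 < ℓ) :
    LinearPIR F (ZMod g) K where
  L := (g - 1) * ℓ
  L_pos := Nat.mul_pos (by omega) hℓ
  Key := Fin K → ZMod g
  Query := Fin K → ZMod g
  len := ℓ
  query := cyclicQuery
  answer := packetSum F g ℓ K
  private_single := exists_equiv_cyclicQuery
  decodable := eq_of_packetSum_cyclicQuery_eq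

end Cyclic

section Cost

variable {F : Type} [Field F] [Fintype F] {N K : ℕ} [NeZero K]

theorem cyclicPIR_download_le {g ℓ : ℕ} [NeZero g] (hg : 2 ≤ g) (hℓ : 0 < ℓ)
    (c : Fin N → Option (ZMod g)) (lead : ZMod g → Fin N) (k : Fin K) (s : ℕ)
    (hs : ∀ i, (members c i).card = s) :
    ∑ n, entropy (Fintype.card F) ((cyclicPIR F g ℓ K hg hℓ).scheme c lead).law
        (((cyclicPIR F g ℓ K hg hℓ).scheme c lead).A k n) ≤
      s * ((g - g / (g : ℝ) ^ K) * ℓ + 1) := by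
  classical
  refine ((cyclicPIR F g ℓ K hg hℓ).scheme_download_le c lead k s hs
    -- The residues in the query of server i add up to i, so only server 0 can receive the null
    -- query.
    (fun i => ℓ + if i = 0 then 1 - g / (g : ℝ) ^ K * ℓ else 0) ?_).trans (le_of_eq ?_)
  · intro i n hn
    split_ifs with hi
    · subst hi
      -- These g keys, out of g^K, vanish off k; for server 0 the correction cancels the remaining
      -- entry.
      let S : Finset (Fin K → ZMod g) :=
        Finset.univ.image fun a : ZMod g => (Pi.single k a : Fin K → ZMod g)
      have hS : S.card = g :=
        (Finset.card_image_of_injective _ (Pi.single_injective k)).trans (by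
          rw [Finset.card_univ, ZMod.card])
      have hnull : ∀ u ∈ S, cyclicQuery k u 0 = 0 := by
        intro u hu
        obtain ⟨a, -, rfl⟩ := Finset.mem_image.1 hu
        simp only [cyclicQuery, Finset.sum_pi_single', Finset.mem_univ, if_true, zero_sub]
        rw [← Pi.single_add, add_neg_cancel, Pi.single_zero]
      have h : entropy (Fintype.card F) ((cyclicPIR F g ℓ K hg hℓ).scheme c lead).law
          (((cyclicPIR F g ℓ K hg hℓ).scheme c lead).A k n) ≤
            1 + (1 - (S.card : ℝ) / (Fintype.card (Fin K → ZMod g) : ℝ)) * ℓ :=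
        (cyclicPIR F g ℓ K hg hℓ).scheme_entropy_le_one_add c lead k hn
          (0 : Fin K → ZMod g) (packetSum_zero F g ℓ K) S hnull
      rw [hS, Fintype.card_fun, Fintype.card_fin, ZMod.card] at h
      refine h.trans (le_of_eq ?_)
      push_cast
      ring
    · rw [add_zero]
      exact entropy_le_length _ _
  · rw [Finset.sum_add_distrib]
    simp only [Finset.sum_const, Finset.card_univ, ZMod.card, nsmul_eq_mul, Finset.sum_ite_eq',
      Finset.mem_univ, if_true]
    ring

theorem trivialPIR_download_le {ι : Type} [Fintype ι] [DecidableEq ι] [Nonempty ι]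
    (c : Fin N → Option ι) (lead : ι → Fin N) (k : Fin K) (s : ℕ)
    (hs : ∀ i, (members c i).card = s) :
    ∑ n, entropy (Fintype.card F) ((trivialPIR F ι K).scheme c lead).law
        (((trivialPIR F ι K).scheme c lead).A k n) ≤ s * (Fintype.card ι * K) := by
  refine ((trivialPIR F ι K).scheme_download_le c lead k s hs (fun _ => (K : ℝ)) ?_).trans
    (le_of_eq (by simp))
  intro i n _
  exact entropy_le_length _ _

end Cost

end LinearPIR

/-! ### Counting links and groups. -/

section Matrices

variable {N M : ℕ} {B : Matrix (Fin N) (Fin M) ℕ}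

theorem compl_apply_of_isBinary (hB : IsBinary B) (n : Fin N) (m : Fin M) :
    compl B n m = if n ∈ (link B m)ᶜ then 1 else 0 := by
  rcases hB n m with h | h <;> simp [compl, link, h]

theorem sum_compl_le_lam (B : Matrix (Fin N) (Fin M) ℕ) (n : Fin N) :
    ∑ m, compl B n m ≤ lam B :=
  Finset.le_sup (f := fun n => ∑ m, compl B n m) (Finset.mem_univ n)

/-- Double counting of the pairs of a link and a server outside it. -/
theorem sum_sum_compl_link_le (hB : IsBinary B) (f : Fin N → ℝ) (hf : ∀ n, 0 ≤ f n) :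
    ∑ m, ∑ n ∈ (link B m)ᶜ, f n ≤ lam B * ∑ n, f n := by
  have h : ∀ m, ∑ n ∈ (link B m)ᶜ, f n = ∑ n, (compl B n m : ℝ) * f n := by
    intro m
    simp_rw [compl_apply_of_isBinary hB, Nat.cast_ite, Nat.cast_one, Nat.cast_zero, ite_mul,
      one_mul, zero_mul]
    rw [Finset.sum_ite_mem, Finset.univ_inter]
  simp_rw [h]
  rw [Finset.sum_comm, Finset.mul_sum]
  refine Finset.sum_le_sum fun n _ => ?_
  rw [← Finset.sum_mul, ← Nat.cast_sum]
  exact mul_le_mul_of_nonneg_right (by exact_mod_cast sum_compl_le_lam B n) (hf n)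

variable {Λ : SimilarityMatrix N}

theorem IsFeasible.eq_of_mem_group (hΛ : IsFeasible B Λ) {i j : Fin ⌈(N : ℚ) / 2⌉₊} {n : Fin N}
    (hi : n ∈ group Λ i) (hj : n ∈ group Λ j) : i = j := by
  by_contra hne
  have h := hΛ.orthogonal i j hne
  simp only [group, Finset.mem_filter, Finset.mem_univ, true_and] at hi hj
  simp only [dotProduct, Finset.sum_eq_zero_iff, Finset.mem_univ, true_imp_iff] at h
  have := h n
  simp [Matrix.row, hi, hj] at this

theorem IsFeasible.exists_mem_group_notMem_link (hB : IsBinary B) (hΛ : IsFeasible B Λ)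
    {i : Fin ⌈(N : ℚ) / 2⌉₊} (hi : Matrix.row Λ i ≠ 0) (m : Fin M) :
    ∃ n ∈ group Λ i, n ∉ link B m := by
  have h := hΛ.secure i hi m
  rw [Matrix.mul_apply] at h
  obtain ⟨n, -, hn⟩ := Finset.exists_ne_zero_of_sum_ne_zero (Nat.one_le_iff_ne_zero.1 h)
  refine ⟨n, ?_, fun hm => hn ?_⟩
  · rcases hΛ.binary i n with h0 | h1
    · simp [h0] at hn
    · simpa [group] using h1
  · rw [compl_apply_of_isBinary hB]
    simp [hm]

theorem IsFeasible.card_group (hΛ : IsFeasible B Λ) (i : Fin ⌈(N : ℚ) / 2⌉₊) :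
    (group Λ i).card = ∑ j, Λ i j := by
  rw [group, Finset.card_filter]
  refine Finset.sum_congr rfl fun j _ => ?_
  rcases hΛ.binary i j with h | h <;> simp [h]

theorem IsFeasible.two_le_card_group [NeZero M] (hB : IsBinary B) (hΛ : IsFeasible B Λ)
    {i : Fin ⌈(N : ℚ) / 2⌉₊} (hi : Matrix.row Λ i ≠ 0) : 2 ≤ (group Λ i).card := by
  obtain ⟨n, hn, -⟩ := hΛ.exists_mem_group_notMem_link hB hi 0
  have h0 : 0 < (group Λ i).card := Finset.card_pos.2 ⟨n, hn⟩
  have h1 := hΛ.no_singleton i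
  rw [← hΛ.card_group] at h1
  omega

/-- Each link misses a member of the group, and each member is missed by at most λ links. -/
theorem IsFeasible.le_lam_mul_card_group (hB : IsBinary B) (hΛ : IsFeasible B Λ)
    {i : Fin ⌈(N : ℚ) / 2⌉₊} (hi : Matrix.row Λ i ≠ 0) : M ≤ lam B * (group Λ i).card := by
  calc M = ∑ _ : Fin M, 1 := by simp
    _ ≤ ∑ m, ∑ n ∈ group Λ i, compl B n m := by
        refine Finset.sum_le_sum fun m _ => ?_
        obtain ⟨n, hn, hm⟩ := hΛ.exists_mem_group_notMem_link hB hi m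
        have h1 : compl B n m = 1 := by
          rw [compl_apply_of_isBinary hB]
          simp [hm]
        rw [← h1]
        exact Finset.single_le_sum (f := fun n => compl B n m) (fun _ _ => Nat.zero_le _) hn
    _ = ∑ n ∈ group Λ i, ∑ m, compl B n m := Finset.sum_comm
    _ ≤ ∑ n ∈ group Λ i, lam B := Finset.sum_le_sum fun n _ => sum_compl_le_lam B n
    _ = lam B * (group Λ i).card := by simp [mul_comm]

/-- If `λ / M = g / ∑ M_i`, then all groups have the size `M / λ`. -/
theorem IsFeasible.lam_mul_card_group [NeZero M] (hB : IsBinary B) (hΛ : IsFeasible B Λ)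
    (hlam : (lam B : ℝ) / (M : ℝ) =
      (numGroups Λ : ℝ) / ((∑ i, (group Λ i).card : ℕ) : ℝ))
    {i : Fin ⌈(N : ℚ) / 2⌉₊} (hi : Matrix.row Λ i ≠ 0) : lam B * (group Λ i).card = M := by
  classical
  set R : Finset (Fin ⌈(N : ℚ) / 2⌉₊) := Finset.univ.filter fun i => Matrix.row Λ i ≠ 0 with hR
  have hcard : R.card = numGroups Λ := by
    rw [hR, numGroups]
  have hsum : ∑ i, (group Λ i).card = ∑ i ∈ R, (group Λ i).card := by
    symm
    refine Finset.sum_subset (Finset.subset_univ _) fun j _ hj => ?_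
    have hj : Matrix.row Λ j = 0 := by simpa [hR] using hj
    rw [hΛ.card_group]
    exact Finset.sum_eq_zero fun n _ => congrFun hj n
  have hpos : 0 < ∑ i, (group Λ i).card :=
    lt_of_lt_of_le (lt_of_lt_of_le two_pos (hΛ.two_le_card_group hB hi))
      (Finset.single_le_sum (f := fun i => (group Λ i).card) (fun _ _ => Nat.zero_le _)
        (Finset.mem_univ i))
  rw [div_eq_div_iff (Nat.cast_ne_zero.2 (NeZero.ne M)) (Nat.cast_ne_zero.2 hpos.ne')] at hlam
  -- Cross-multiplied, the hypothesis says that the bounds M ≤ λ·M_i have equal sums over the rows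
  -- in use, so each of them is an equality.
  have hlam' : ∑ _ ∈ R, M = ∑ i ∈ R, lam B * (group Λ i).card := by
    rw [Finset.sum_const, hcard, smul_eq_mul, ← Finset.mul_sum, ← hsum]
    exact_mod_cast hlam.symm
  exact ((Finset.sum_eq_sum_iff_of_le fun j hj =>
    hΛ.le_lam_mul_card_group hB (Finset.mem_filter.1 hj).2).1 hlam' i (by simp [hi])).symm

theorem numGroups_le (Λ : SimilarityMatrix N) : numGroups Λ ≤ N := by
  classical
  have h1 : numGroups Λ ≤ ⌈(N : ℚ) / 2⌉₊ := by
    refine (Finset.card_le_univ _).trans (by simp)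
  refine h1.trans (Nat.ceil_le.2 ?_)
  have : (0 : ℚ) ≤ N := Nat.cast_nonneg N
  linarith

/-- The rows in use, indexed by residues, as an assignment of the servers to groups. -/
theorem IsFeasible.exists_assignment [NeZero M] (hB : IsBinary B) (hΛ : IsFeasible B Λ)
    {g : ℕ} [NeZero g] (hg : g = numGroups Λ) :
    ∃ (r : ZMod g → Fin ⌈(N : ℚ) / 2⌉₊) (c : Fin N → Option (ZMod g)) (lead : ZMod g → Fin N),
      (∀ i, Matrix.row Λ (r i) ≠ 0) ∧ (∀ T ∈ groups Λ, ∃ i, T = group Λ (r i)) ∧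
      (∀ i, members c i = group Λ (r i)) ∧ ∀ i, c (lead i) = some i := by
  classical
  have hcard : Fintype.card (ZMod g) = Fintype.card {i // Matrix.row Λ i ≠ 0} := by
    rw [ZMod.card, hg, numGroups, Fintype.card_subtype]
  let e := Fintype.equivOfCardEq hcard
  let c : Fin N → Option (ZMod g) := fun n =>
    if h : ∃ i, n ∈ group Λ (e i) then some h.choose else none
  have hc : ∀ n i, c n = some i ↔ n ∈ group Λ (e i) := by
    intro n i
    constructor
    · intro h
      by_cases hn : ∃ i, n ∈ group Λ (e i)
      · simp only [c, dif_pos hn, Option.some.injEq] at h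
        rw [← h]
        exact hn.choose_spec
      · simp [c, dif_neg hn] at h
    · intro h
      have hn : ∃ i, n ∈ group Λ (e i) := ⟨i, h⟩
      simp only [c, dif_pos hn, Option.some.injEq]
      exact e.injective (Subtype.ext (hΛ.eq_of_mem_group hn.choose_spec h))
  have hne : ∀ i, ∃ n, n ∈ group Λ (e i) := fun i =>
    Finset.card_pos.1 (lt_of_lt_of_le two_pos (hΛ.two_le_card_group hB (e i).2))
  choose lead hlead using hne
  refine ⟨fun i => e i, c, lead, fun i => (e i).2, fun T hT => ?_, fun i => ?_, fun i =>
    (hc _ _).2 (hlead i)⟩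
  · simp only [groups, Finset.mem_image, Finset.mem_filter] at hT
    obtain ⟨j, ⟨-, hj⟩, rfl⟩ := hT
    exact ⟨e.symm ⟨j, hj⟩, by simp⟩
  · ext n
    simp [members, hc]

end Matrices

/-! ### The two bounds for the capacity. -/

section Capacity

variable {F : Type} [Field F] [Fintype F] {N K : ℕ} [NeZero K]

/-- This matches the cost g - g/g^K per packet symbol of the cyclic scheme with its message length g
- 1. -/
theorem geom_sum_mul_sub_one (g K : ℕ) (hg : 0 < g) :
    (∑ i ∈ Finset.range K, (1 / (g : ℝ)) ^ i) * (g - 1) = g - g / (g : ℝ) ^ K := by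
  have hg' : (g : ℝ) ≠ 0 := by exact_mod_cast hg.ne'
  have h := geom_sum_mul (1 / (g : ℝ)) K
  have h2 : (g : ℝ) - 1 = -(g * (1 / (g : ℝ) - 1)) := by field_simp; ring
  rw [h2, mul_neg, mul_left_comm, h, one_div, inv_pow]
  field_simp
  ring

theorem geom_sum_one_div_pos (g K : ℕ) [NeZero K] :
    0 < ∑ i ∈ Finset.range K, (1 / (g : ℝ)) ^ i := by
  obtain ⟨j, hj⟩ := Nat.exists_eq_succ_of_ne_zero (NeZero.ne K)
  rw [hj, Nat.succ_eq_add_one, Finset.sum_range_succ']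
  positivity

theorem entropy_nonneg {Ω β : Type} [Fintype Ω] [Fintype β] (P : PMF Ω) (X : Ω → β) :
    0 ≤ entropy (Fintype.card F) P X :=
  div_nonneg (ent_nonneg P X) (Scheme.log_card_pos F).le

/-- The converse: a lower bound for the download cost. -/
theorem Scheme.IsAdmissible.download_ge {M g : ℕ} {B : Matrix (Fin N) (Fin M) ℕ}
    (hB : IsBinary B) (hg : 0 < g) (hX : ∀ m, (link B m)ᶜ.card = g)
    {𝒯 : Finset (Finset (Fin N))} {σ : Scheme F N K} (hσ : σ.IsAdmissible (links B) 𝒯)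
    (k : Fin K) :
    M * (σ.L * ∑ i ∈ Finset.range K, (1 / (g : ℝ)) ^ i) ≤
      lam B * ∑ n, entropy (Fintype.card F) σ.law (σ.A k n) := by
  refine le_trans ?_ (sum_sum_compl_link_le hB _ fun n => entropy_nonneg (F := F) _ _)
  have h : ∀ m, σ.L * ∑ i ∈ Finset.range K, (1 / (g : ℝ)) ^ i ≤
      ∑ n ∈ (link B m)ᶜ, entropy (Fintype.card F) σ.law (σ.A k n) := by
    intro m
    have := σ.geom_sum_le_sum_ent (hσ.secure_link (link B m)
      (Finset.mem_image_of_mem _ (Finset.mem_univ m))) hσ.decodable hσ.private_single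
      (by rw [hX]; exact hg) k
    rwa [hX] at this
  have := Finset.sum_le_sum fun m (_ : m ∈ Finset.univ) => h m
  simpa using this

/-- Positivity matters because division by a zero download would give rate 0. -/
theorem mem_achievableRates {𝒳 𝒯 : Finset (Finset (Fin N))} {σ : Scheme F N K}
    (hσ : σ.IsAdmissible 𝒳 𝒯) {D : ℝ}
    (hpos : ∀ k, 0 < ∑ n, entropy (Fintype.card F) σ.law (σ.A k n))
    (hD : ∀ k, ∑ n, entropy (Fintype.card F) σ.law (σ.A k n) ≤ D) :
    σ.L / D ∈ achievableRates F N K 𝒳 𝒯 :=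
  ⟨σ, hσ, fun k => div_le_div_of_nonneg_left (Nat.cast_nonneg _) (hpos k) (hD k)⟩

/-- Achievability: a server of a `g`-server scheme is replaced by `s` servers. -/
theorem le_of_mem_upperBounds_achievableRates {g s : ℕ} [NeZero g] (hs : 2 ≤ s)
    (c : Fin N → Option (ZMod g)) (lead : ZMod g → Fin N) (hlead : ∀ i, c (lead i) = some i)
    (hcard : ∀ i, (members c i).card = s) {𝒳 𝒯 : Finset (Finset (Fin N))}
    (h𝒳 : ∀ X ∈ 𝒳, ∀ i, ∃ n, c n = some i ∧ n ∉ X)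
    (h𝒯 : ∀ T ∈ 𝒯, ∃ i, ∀ n ∈ T, c n = some i)
    (hpos : ∀ σ : Scheme F N K, σ.IsAdmissible 𝒳 𝒯 → ∀ k,
      0 < ∑ n, entropy (Fintype.card F) σ.law (σ.A k n))
    {b : ℝ} (hb : b ∈ upperBounds (achievableRates F N K 𝒳 𝒯)) :
    1 / (s * ∑ i ∈ Finset.range K, (1 / (g : ℝ)) ^ i) ≤ b := by
  have hadm := fun π : LinearPIR F (ZMod g) K =>
    π.scheme_isAdmissible c lead hlead (fun i => (hcard i).symm ▸ hs) h𝒳 h𝒯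
  have hg1 : 1 ≤ g := Nat.pos_of_ne_zero (NeZero.ne g)
  have hs0 : (0 : ℝ) < s := by exact_mod_cast (by omega : 0 < s)
  have hK : (0 : ℝ) < K := by exact_mod_cast Nat.pos_of_ne_zero (NeZero.ne K)
  -- For g = 1 the cyclic scheme would have message length 0, so downloading everything takes its
  -- place.
  rcases hg1.eq_or_lt with rfl | hg
  · have := hb (mem_achievableRates (hadm (LinearPIR.trivialPIR F (ZMod 1) K)) (hpos _ (hadm _))
      fun k => LinearPIR.trivialPIR_download_le c lead k s hcard)
    refine le_trans (le_of_eq ?_) this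
    change _ = ((1 : ℕ) : ℝ) / _
    rw [ZMod.card]
    simp
  · set D : ℝ := ∑ i ∈ Finset.range K, (1 / (g : ℝ)) ^ i with hDdef
    have hD : 0 < D := geom_sum_one_div_pos g K
    have hDg : D * (g - 1) = g - g / (g : ℝ) ^ K := geom_sum_mul_sub_one g K hg1
    have hg' : (0 : ℝ) < g - 1 := by
      have : (1 : ℝ) < g := by exact_mod_cast hg
      linarith
    have key : ∀ ℓ : ℕ, 0 < ℓ → (g - 1) * (ℓ : ℝ) ≤ b * (s * (D * (g - 1) * ℓ + 1)) := by
      intro ℓ hℓ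
      have hℓ' : (0 : ℝ) < ℓ := by exact_mod_cast hℓ
      have := hb (mem_achievableRates (hadm (LinearPIR.cyclicPIR F g ℓ K hg hℓ))
        (hpos _ (hadm _)) fun k => LinearPIR.cyclicPIR_download_le hg hℓ c lead k s hcard)
      rw [← hDg, div_le_iff₀ (by positivity)] at this
      refine le_trans (le_of_eq ?_) this
      change _ = (((g - 1) * ℓ : ℕ) : ℝ)
      rw [Nat.cast_mul, Nat.cast_sub hg1, Nat.cast_one]
    by_contra! hlt
    rw [lt_div_iff₀ (by positivity)] at hlt
    -- If b were smaller than the limit rate, `key` would bound ℓ times this positive constant by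
    -- b·s, which fails for large ℓ. The maximum with 0 below keeps ℓ positive whatever the sign of
    -- b.
    have hε : 0 < (g - 1) * (1 - b * (s * D)) := mul_pos hg' (by linarith)
    obtain ⟨ℓ, hℓ⟩ := exists_nat_gt (max 0 (b * s / ((g - 1) * (1 - b * (s * D)))))
    have hℓ0 : (0 : ℝ) < ℓ := (le_max_left _ _).trans_lt hℓ
    have h1 := (le_max_right _ _).trans_lt hℓ
    rw [div_lt_iff₀ hε] at h1
    have h2 := key ℓ (by exact_mod_cast hℓ0)
    linarith

end Capacity

end

end AXPIR

open AXPIR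

theorem theorem4 (F : Type) [Field F] [Fintype F] (N K M : ℕ) [NeZero K] [NeZero M]
    (B : Matrix (Fin N) (Fin M) ℕ) (hB : AXPIR.IsBinary B)
    (Λ : AXPIR.SimilarityMatrix N) (hΛ : AXPIR.IsOptimalGrouping B Λ)
    (g : ℕ) (hg : g = AXPIR.numGroups Λ) (hg0 : 0 < g)
    (hlam : (AXPIR.lam B : ℝ) / (M : ℝ) = (g : ℝ) / ((∑ i, (AXPIR.group Λ i).card : ℕ) : ℝ))
    (hX : ∀ m, (AXPIR.link B m).card = N - g) :
    AXPIR.IsCapacity F N K (AXPIR.links B) (AXPIR.groups Λ)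
        ((AXPIR.lam B : ℝ) / ((M : ℝ) * (1 + AXPIR.eta K (AXPIR.link B 0)))) ∧
      (AXPIR.lam B : ℝ) / ((M : ℝ) * (1 + AXPIR.eta K (AXPIR.link B 0))) =
        (AXPIR.lam B : ℝ) / (M : ℝ) * AXPIR.CPIR (N - (AXPIR.link B 0).card) K ∧
      (AXPIR.lam B : ℝ) / (M : ℝ) * AXPIR.CPIR (N - (AXPIR.link B 0).card) K =
        (AXPIR.lam B : ℝ) / (M : ℝ) * AXPIR.CPIR g K := by
  have hgN : g ≤ N := hg ▸ numGroups_le Λ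
  have : NeZero g := ⟨hg0.ne'⟩
  have hfeas := hΛ.1
  have hNg : N - (link B 0).card = g := by rw [hX]; omega
  have hcompl : ∀ m, (link B m)ᶜ.card = g := by
    intro m
    rw [Finset.card_compl, Fintype.card_fin, hX]
    omega
  set D : ℝ := ∑ i ∈ Finset.range K, (1 / (g : ℝ)) ^ i with hDdef
  have hD : 0 < D := geom_sum_one_div_pos g K
  have heta : 1 + eta K (link B 0) = D := by
    have h : (N : ℝ) - ((link B 0).card : ℝ) = g := by
      rw [hX, Nat.cast_sub hgN]
      ring
    rw [eta, etaT, h, hDdef, Finset.range_eq_Ico,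
      Finset.sum_eq_sum_Ico_succ_bot (Nat.pos_of_ne_zero (NeZero.ne K))]
    simp
  have hM : (0 : ℝ) < M := by exact_mod_cast Nat.pos_of_ne_zero (NeZero.ne M)
  refine ⟨?_, ?_, by rw [hNg]⟩
  · rw [heta]
    obtain ⟨r, c, lead, hr, hgroups, hmem, hlead⟩ := hfeas.exists_assignment hB hg
    have hsize : ∀ i, lam B * (group Λ (r i)).card = M := fun i =>
      hfeas.lam_mul_card_group hB (hg ▸ hlam) (hr i)
    have hlam0 : 0 < lam B := by
      by_contra h
      have := hsize 0
      rw [Nat.eq_zero_of_not_pos h, zero_mul] at this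
      exact NeZero.ne M this.symm
    have hlam0' : (0 : ℝ) < lam B := by exact_mod_cast hlam0
    constructor
    · rintro R ⟨σ, hσ, hR⟩
      refine (hR 0).trans ?_
      have h := hσ.download_ge hB hg0 hcompl 0
      have hL : (0 : ℝ) < σ.L := by exact_mod_cast σ.L_pos
      -- The converse bound itself excludes a zero download, as its left side is positive.
      have hpos : 0 < ∑ n, entropy (Fintype.card F) σ.law (σ.A 0 n) :=
        pos_of_mul_pos_right (lt_of_lt_of_le (by positivity) h) hlam0'.le
      rw [Scheme.rate, div_le_div_iff₀ hpos (by positivity)]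
      linarith
    · intro b hb
      have hcard : ∀ i, (members c i).card = (group Λ (r 0)).card := fun i => by
        rw [hmem]
        exact Nat.eq_of_mul_eq_mul_left hlam0 ((hsize i).trans (hsize 0).symm)
      have hmem' : ∀ n i, c n = some i ↔ n ∈ group Λ (r i) := fun n i => by
        rw [← hmem]
        simp [members]
      have h := le_of_mem_upperBounds_achievableRates
        (hfeas.two_le_card_group hB (hr 0)) c lead hlead hcard ?_ ?_ ?_ hb
      · refine le_trans (le_of_eq ?_) h
        have h0 : (0 : ℝ) < (group Λ (r 0)).card := by
          exact_mod_cast two_pos.trans_le (hfeas.two_le_card_group hB (hr 0))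
        have hMs : (lam B : ℝ) * (group Λ (r 0)).card = M := by exact_mod_cast hsize 0
        rw [← hDdef, div_eq_div_iff (by positivity) (by positivity)]
        linear_combination D * hMs
      · intro X hX i
        obtain ⟨m, -, rfl⟩ := Finset.mem_image.1 hX
        obtain ⟨n, hn, hnm⟩ := hfeas.exists_mem_group_notMem_link hB (hr i) m
        exact ⟨n, (hmem' n i).2 hn, hnm⟩
      · intro T hT
        obtain ⟨i, rfl⟩ := hgroups T hT
        exact ⟨i, fun n hn => (hmem' n i).2 hn⟩
      · intro σ hσ k
        have hL : (0 : ℝ) < σ.L := by exact_mod_cast σ.L_pos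
        exact pos_of_mul_pos_right (lt_of_lt_of_le (by positivity)
          (hσ.download_ge hB hg0 hcompl k)) hlam0'.le
  · rw [heta, hNg, CPIR, ← hDdef]
    field_simp
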